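/- Let $d\ge 1$ and let $A$ be an integer $d\times d$ matrix that is a dilation matrix (all eigenvalues are greater than $1$ in absolute value) and isotropic (diagonalizable over $\mathbb C$ with all eigenvalues equal in absolute value). Put $q:=|\det A|$ and $A^{-T}:=(A^T)^{-1}$, and let $Q$ be any real symmetric positive definite matrix with $$A^{-T}=q^{-1/d}\,Q^{-1}UQ\quad\text{for some orthogonal matrix }U .$$ With $Q^2=(q_{ij})$ define, for $\xi\in\mathbb R^d$, $$G(\xi):=4\sum_{i}q_{ii}\sin^2\frac{\xi_i}{2}+2\sum_{i<j}q_{ij}\sin\xi_i\sin\xi_j,\qquad m_0(\xi):=\frac{\prod_{s\in S\setminus\{0\}}G(\xi+2\pi s)}{\prod_{s\in S\setminus\{0\}}G(2\pi s)},$$ where $S:=\{s\in[0,1)^d: A^Ts\in\mathbb Z^d\}$, and $$\mu(\xi):=\frac{q^{2/d}\,m_0(A^{-T}\xi)\,G(A^{-T}\xi)}{G(\xi)}$$ (extended continuously by the value $1$ at the zeros of $G$, i.e. at the points of $2\pi\mathbb Z^d$), $\mathcal B:=\sup_{\xi\in\mathbb R^d}\mu(\xi)$. For $m\ge 1$ let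 the elliptic scaling function $\phi^m$ be the tempered distribution on $\mathbb R^d$ whose Fourier transform (in the convention $\hat f(\xi)=\int f(x)e^{-i\xi\cdot x}\,dx$) is the function $$\widehat{\phi^m}(\xi)=\bigl(\hat\phi(\xi)\bigr)^m,\qquad \hat\phi(\xi):=\prod_{j=1}^\infty m_0\bigl((A^{-T})^j\xi\bigr).$$ If $$\mathcal B<|\det A|^{\frac2d-\frac1{2m}},$$ then there is exactly one such distribution $\phi^m$; it belongs to $L^2(\mathbb R^d)$; its integer shifts form a Riesz basis of their closed linear span in $L^2(\mathbb R^d)$, i.e. there are constants $0<a\le b<\infty$ such that $$a\sum_{k}|c_k|^2\le\Bigl\|\sum_{k}c_k\,\phi^m(\cdot-k)\Bigr\|_{L^2(\mathbb R^d)}^2\le b\sum_{k}|c_k|^2$$ for all finitely supported complex sequences $(c_k)_{k\in\mathbb Z^d}$; and the series $\sum_{k\in\mathbb Z^d}|\widehat{\phi^m}(\xi+2\pi k)|^2$ converges for every $\xi\in\mathbb R^d$. -/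

import Mathlib

open MeasureTheory
open scoped SchwartzMap FourierTransform Matrix

noncomputable section

namespace EllipticScaling

/-- An integer matrix, read as a real matrix. -/
abbrev realMat {d : ℕ} (A : Matrix (Fin d) (Fin d) ℤ) : Matrix (Fin d) (Fin d) ℝ :=
  A.map (fun n : ℤ => (n : ℝ))

/-- An integer matrix, read as a complex matrix. -/
abbrev complexMat {d : ℕ} (A : Matrix (Fin d) (Fin d) ℤ) : Matrix (Fin d) (Fin d) ℂ :=
  A.map (fun n : ℤ => (n : ℂ))

/-- Dilation matrix: an integer matrix all of whose (complex) eigenvalues are greater than `1`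
in absolute value. -/
def IsDilation {d : ℕ} (A : Matrix (Fin d) (Fin d) ℤ) : Prop :=
  ∀ z ∈ spectrum ℂ (complexMat A), 1 < ‖z‖

/-- Isotropic matrix: diagonalizable over `ℂ`, with all eigenvalues equal in absolute value. -/
def IsIsotropic {d : ℕ} (A : Matrix (Fin d) (Fin d) ℤ) : Prop :=
  (∃ (S : Matrix (Fin d) (Fin d) ℂ) (D : Fin d → ℂ),
      IsUnit S ∧ complexMat A * S = S * Matrix.diagonal D) ∧
    ∀ z ∈ spectrum ℂ (complexMat A), ∀ w ∈ spectrum ℂ (complexMat A), ‖z‖ = ‖w‖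

/-- `q = |det A|`. -/
def absDet {d : ℕ} (A : Matrix (Fin d) (Fin d) ℤ) : ℝ := |(A.det : ℝ)|

/-- The matrix `A^{-T}`. -/
def invTranspose {d : ℕ} (A : Matrix (Fin d) (Fin d) ℤ) : Matrix (Fin d) (Fin d) ℝ :=
  ((realMat A)⁻¹)ᵀ

/-- `Q` is a similarity transformation matrix of `A`: it is symmetric positive definite, and
`A^{-T} = q^{-1/d} Q⁻¹ U Q` for some orthogonal matrix `U`. -/
def IsSimilarityMatrix {d : ℕ} (A : Matrix (Fin d) (Fin d) ℤ) (Q : Matrix (Fin d) (Fin d) ℝ) :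
    Prop :=
  Q.PosDef ∧ ∃ U ∈ Matrix.orthogonalGroup (Fin d) ℝ,
    invTranspose A = (1 / absDet A ^ (1 / (d : ℝ))) • (Q⁻¹ * U * Q)

/-- The trigonometric polynomial
`G(ξ) = 4 ∑ᵢ q_{ii} sin² (ξᵢ / 2) + 2 ∑_{i < j} q_{ij} sin ξᵢ sin ξⱼ`, with `Q² = (q_{ij})`. -/
def G {d : ℕ} (Q : Matrix (Fin d) (Fin d) ℝ) (ξ : Fin d → ℝ) : ℝ :=
  4 * ∑ i, (Q ^ 2) i i * Real.sin (ξ i / 2) ^ 2 +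
    2 * ∑ i, ∑ j ∈ Finset.Ioi i, (Q ^ 2) i j * Real.sin (ξ i) * Real.sin (ξ j)

/-- The set `S(B)` of the points `s ∈ [0,1)^d` such that `B s` is an integer vector. For a
nonsingular `B` it is finite, with `|det B|` elements. -/
def digitPoints {d : ℕ} (B : Matrix (Fin d) (Fin d) ℤ) : Set (Fin d → ℝ) :=
  {s | (∀ i, s i ∈ Set.Ico (0 : ℝ) 1) ∧ ∃ n : Fin d → ℤ, realMat B *ᵥ s = fun i => (n i : ℝ)}

/-- The mask `m₀`. -/
def mask {d : ℕ} (A : Matrix (Fin d) (Fin d) ℤ) (Q : Matrix (Fin d) (Fin d) ℝ)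
    (ξ : Fin d → ℝ) : ℝ :=
  (∏ᶠ s ∈ digitPoints Aᵀ \ {0}, G Q (ξ + (2 * Real.pi) • s)) /
    (∏ᶠ s ∈ digitPoints Aᵀ \ {0}, G Q ((2 * Real.pi) • s))

open Classical in
/-- The function `μ(ξ) = q^{2/d} m₀(A^{-T} ξ) G(A^{-T} ξ) / G(ξ)`. The quotient has removable
singularities at the zeros of `G` (the points of `2πℤ^d`), where its continuous extension takes
the value `1`. -/
def mu {d : ℕ} (A : Matrix (Fin d) (Fin d) ℤ) (Q : Matrix (Fin d) (Fin d) ℝ)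
    (ξ : Fin d → ℝ) : ℝ :=
  if G Q ξ = 0 then 1
  else absDet A ^ (2 / (d : ℝ)) * mask A Q (invTranspose A *ᵥ ξ) * G Q (invTranspose A *ᵥ ξ) /
    G Q ξ

/-- The constant `𝓑 = sup_ξ μ(ξ)` (the function `μ` is bounded). -/
def supMu {d : ℕ} (A : Matrix (Fin d) (Fin d) ℤ) (Q : Matrix (Fin d) (Fin d) ℝ) : ℝ :=
  ⨆ ξ : Fin d → ℝ, mu A Q ξ

/-- The Fourier transform `∏_{j ≥ 1} m₀((A^{-T})^j ξ)` of the elliptic scaling function `φ` of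
the first order, in the convention `∫ φ(x) e^{-i ξ·x} dx`. -/
def phiHat {d : ℕ} (A : Matrix (Fin d) (Fin d) ℤ) (Q : Matrix (Fin d) (Fin d) ℝ)
    (ξ : Fin d → ℝ) : ℝ :=
  ∏' j : ℕ, mask A Q ((invTranspose A ^ (j + 1)) *ᵥ ξ)

/-- The tempered distribution `T` is the elliptic scaling function `φ^m` of order `m`: its
Fourier transform, in the convention `∫ T(x) e^{-i ξ·x} dx`, is the function `(φ̂)^m`. As Mathlib's
`𝓕` has the kernel `e^{-2π i ν·x}`, this says that `𝓕 T` is the function `ν ↦ φ̂(2πν)^m`. -/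
def IsEllipticScalingFunction {d : ℕ} (A : Matrix (Fin d) (Fin d) ℤ)
    (Q : Matrix (Fin d) (Fin d) ℝ) (m : ℕ) (T : 𝓢'(EuclideanSpace ℝ (Fin d), ℂ)) : Prop :=
  ∀ f : 𝓢(EuclideanSpace ℝ (Fin d), ℂ),
    Integrable (fun ν => f ν * ((phiHat A Q ((2 * Real.pi) • ν.ofLp) ^ m : ℝ) : ℂ)) ∧
      (𝓕 T) f = ∫ ν, f ν * ((phiHat A Q ((2 * Real.pi) • ν.ofLp) ^ m : ℝ) : ℂ)

/-- The shift `φ(· - k)` of an `L²` function by an integer vector `k`. -/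
def integerShift {d : ℕ} (k : Fin d → ℤ)
    (φ : Lp ℂ 2 (volume : Measure (EuclideanSpace ℝ (Fin d)))) :
    Lp ℂ 2 (volume : Measure (EuclideanSpace ℝ (Fin d))) :=
  Lp.compMeasurePreserving (fun x => x - WithLp.toLp 2 (fun i => (k i : ℝ)))
    (measurePreserving_sub_right volume _) φ

/-- The family `f` forms a Riesz basis (of the closure of its linear span): there are Riesz bounds
`0 < a ≤ b` with `a ∑ |cᵢ|² ≤ ‖∑ cᵢ fᵢ‖² ≤ b ∑ |cᵢ|²` for all finitely supported `c`. -/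
def FormsRieszBasis {ι H : Type*} [NormedAddCommGroup H] [InnerProductSpace ℂ H]
    (f : ι → H) : Prop :=
  ∃ a b : ℝ, 0 < a ∧ a ≤ b ∧ ∀ c : ι →₀ ℂ,
    a * (∑ i ∈ c.support, ‖c i‖ ^ 2) ≤ ‖∑ i ∈ c.support, c i • f i‖ ^ 2 ∧
      ‖∑ i ∈ c.support, c i • f i‖ ^ 2 ≤ b * (∑ i ∈ c.support, ‖c i‖ ^ 2)

end EllipticScaling

end

/-!
Since `A^{-T} = q^{-1/d} Q⁻¹ U Q` with `U` orthogonal, `A^{-T}` contracts the norm `|Qξ|` exactly by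
the factor `q^{-1/d}`. Moreover `G(ξ) = 4 ∑ᵢ q_{ii} sin⁴ (ξᵢ / 2) + |Q (sin ξᵢ)ᵢ|²` is nonnegative,
vanishes only on `2πℤ^d`, and is comparable to `|Qξ|²` near the origin. The definition of `𝓑` reads
`m₀(A^{-T}ξ) G(A^{-T}ξ) ≤ 𝓑 q^{-2/d} G(ξ)`. Iterating this together with
`φ̂(ξ) = m₀(A^{-T}ξ) φ̂(A^{-T}ξ)` until `(A^{-T})^n ξ` reaches a fixed annulus, on which `G` is
bounded below, gives `φ̂(ξ) ≤ C (𝓑 q^{-2/d})^n` with `|ξ| ≈ q^{n/d}`. Hence `φ̂ = O((1 + |ξ|)^{-σ})`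
as soon as `𝓑 ≤ q^{(2 - σ)/d}`, and the hypothesis on `𝓑` leaves room for some `σ > d / (2m)`. The
periodization of `|φ̂|^{2m}` therefore converges locally uniformly. It is also bounded below by a
positive constant, because zeros of `m₀` map under `A^T` into `2πℤ^d`, so that `φ̂`, with
`φ̂(0) = 1`, has no zero in the cube `[-π, π]^d`. By Plancherel these two bounds for the
periodization are Riesz bounds for the integer shifts of `φ^m`.
-/

namespace EllipticScaling

/-! ### Energy norms -/

section EnergyNorm

variable {ι : Type*} [Fintype ι]

/-- The norm `|Q v|`, where `|·|` is the Euclidean norm. For the similarity transformation matrix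
`Q` of `A` it is the norm for which `A^{-T}` is a similarity, and `energyNorm 1` is the Euclidean
norm on the type `ι → ℝ`, whose own norm is the supremum norm. -/
noncomputable def energyNorm (Q : Matrix ι ι ℝ) (v : ι → ℝ) : ℝ :=
  ‖(WithLp.toLp 2 (Q *ᵥ v) : EuclideanSpace ℝ ι)‖

lemma energyNorm_nonneg (Q : Matrix ι ι ℝ) (v : ι → ℝ) : 0 ≤ energyNorm Q v :=
  norm_nonneg _

@[fun_prop]
lemma continuous_energyNorm (Q : Matrix ι ι ℝ) : Continuous (energyNorm Q) := by
  unfold energyNorm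
  fun_prop

lemma energyNorm_sq (Q : Matrix ι ι ℝ) (v : ι → ℝ) :
    energyNorm Q v ^ 2 = ∑ i, (Q *ᵥ v) i ^ 2 :=
  EuclideanSpace.real_norm_sq_eq _

lemma energyNorm_mulVec (Q M : Matrix ι ι ℝ) (v : ι → ℝ) :
    energyNorm Q (M *ᵥ v) = energyNorm (Q * M) v := by
  rw [energyNorm, energyNorm, Matrix.mulVec_mulVec]

variable [DecidableEq ι]

lemma energyNorm_one_sq (v : ι → ℝ) : energyNorm 1 v ^ 2 = ∑ i, v i ^ 2 := by
  rw [energyNorm_sq, Matrix.one_mulVec]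

lemma norm_le_energyNorm_one (v : ι → ℝ) : ‖v‖ ≤ energyNorm 1 v := by
  refine (pi_norm_le_iff_of_nonneg (energyNorm_nonneg 1 v)).2 fun i => ?_
  simpa only [energyNorm, Matrix.one_mulVec] using
    PiLp.norm_apply_le (WithLp.toLp 2 v : EuclideanSpace ℝ ι) i

lemma energyNorm_eq_zero {Q : Matrix ι ι ℝ} (hQ : IsUnit Q) {v : ι → ℝ} :
    energyNorm Q v = 0 ↔ v = 0 := by
  rw [energyNorm, norm_eq_zero, WithLp.toLp_eq_zero]
  exact (Matrix.mulVec_injective_of_isUnit hQ).eq_iff' (Matrix.mulVec_zero Q)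

lemma exists_energyNorm_le_mul (P : Matrix ι ι ℝ) {Q : Matrix ι ι ℝ} (hQ : IsUnit Q) :
    ∃ C : ℝ, 0 < C ∧ ∀ v, energyNorm P v ≤ C * energyNorm Q v := by
  obtain ⟨C, hC, hbound⟩ := (Matrix.toEuclideanCLM (𝕜 := ℝ) (P * Q⁻¹)).bound
  refine ⟨C, hC, fun v => ?_⟩
  have hPQ : P * Q⁻¹ * Q = P := by
    rw [mul_assoc, Matrix.nonsing_inv_mul Q ((Matrix.isUnit_iff_isUnit_det Q).1 hQ), mul_one]
  simpa only [energyNorm, Matrix.toEuclideanCLM_toLp, Matrix.mulVec_mulVec, hPQ] using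
    hbound (WithLp.toLp 2 (Q *ᵥ v))

lemma energyNorm_sq_eq_sum_sum {Q : Matrix ι ι ℝ} (hQ : Q.IsSymm) (v : ι → ℝ) :
    energyNorm Q v ^ 2 = ∑ i, ∑ j, (Q ^ 2) i j * v i * v j := by
  have h : energyNorm Q v ^ 2 = v ⬝ᵥ ((Q ^ 2) *ᵥ v) := by
    rw [energyNorm_sq, pow_two Q, ← Matrix.mulVec_mulVec, Matrix.dotProduct_mulVec,
      ← Matrix.mulVec_transpose, hQ.eq]
    exact Finset.sum_congr rfl fun i _ => pow_two _
  rw [h]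
  simp only [dotProduct, Matrix.mulVec, Finset.mul_sum]
  exact Finset.sum_congr rfl fun i _ => Finset.sum_congr rfl fun j _ => by ring

lemma energyNorm_single_sq {Q : Matrix ι ι ℝ} (hQ : Q.IsSymm) (i : ι) :
    energyNorm Q (Pi.single i 1) ^ 2 = (Q ^ 2) i i := by
  rw [energyNorm_sq_eq_sum_sum hQ]
  simp [Pi.single_apply]

end EnergyNorm

/-! ### The lattice `2πℤ^d` -/

section Lattice

variable {ι : Type*}

/-- The integer vector `k`, read as a real vector. -/
abbrev intVec (k : ι → ℤ) : ι → ℝ := fun i => (k i : ℝ)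

/-- The point `2πk` of the period lattice of `G`. -/
noncomputable def latticePoint (k : ι → ℤ) : ι → ℝ := (2 * Real.pi) • intVec k

lemma latticePoint_apply (k : ι → ℤ) (i : ι) : latticePoint k i = 2 * Real.pi * k i := rfl

lemma latticePoint_zero : latticePoint (0 : ι → ℤ) = 0 := by
  ext i
  simp [latticePoint_apply]

lemma eq_zero_of_norm_latticePoint_le_pi [Fintype ι] {k : ι → ℤ}
    (hk : ‖latticePoint k‖ ≤ Real.pi) : k = 0 := by
  ext i
  have hi : |2 * Real.pi * (k i : ℝ)| ≤ Real.pi := (norm_le_pi_norm (latticePoint k) i).trans hk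
  rw [abs_mul, abs_of_pos Real.two_pi_pos] at hi
  have hlt : |(k i : ℝ)| < 1 := by nlinarith [Real.pi_pos]
  exact Int.abs_lt_one_iff.1 (by exact_mod_cast hlt)

lemma exists_eq_add_latticePoint [Fintype ι] (ξ : ι → ℝ) :
    ∃ ζ k, ξ = ζ + latticePoint k ∧ ‖ζ‖ ≤ Real.pi := by
  have hpi := Real.pi_pos
  refine ⟨ξ - latticePoint fun i => round (ξ i / (2 * Real.pi)),
    fun i => round (ξ i / (2 * Real.pi)), (sub_add_cancel _ _).symm, ?_⟩
  refine (pi_norm_le_iff_of_nonneg hpi.le).2 fun i => ?_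
  have hround := abs_sub_round (ξ i / (2 * Real.pi))
  have hscale : ξ i - 2 * Real.pi * round (ξ i / (2 * Real.pi)) =
      2 * Real.pi * (ξ i / (2 * Real.pi) - round (ξ i / (2 * Real.pi))) := by
    field_simp
  rw [Pi.sub_apply, latticePoint_apply, hscale, Real.norm_eq_abs, abs_mul,
    abs_of_pos Real.two_pi_pos]
  nlinarith

end Lattice

/-! ### The trigonometric polynomial `G` -/

lemma sum_sum_eq_sum_diag_add_two_mul_sum_Ioi {ι R : Type*} [Fintype ι] [LinearOrder ι]
    [LocallyFiniteOrderTop ι] [LocallyFiniteOrderBot ι] [CommSemiring R] {f : ι → ι → R}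
    (hf : ∀ i j, f i j = f j i) :
    ∑ i, ∑ j, f i j = ∑ i, f i i + 2 * ∑ i, ∑ j ∈ Finset.Ioi i, f i j := by
  have hrow (i : ι) : ∑ j, f i j = f i i + ∑ j ∈ {i}ᶜ, f j i := by
    rw [← Finset.sum_compl_add_sum {i}, Finset.sum_singleton, add_comm]
    exact congrArg _ (Finset.sum_congr rfl fun j _ => hf i j)
  rw [Finset.sum_congr rfl fun i _ => hrow i, Finset.sum_add_distrib,
    ← Finset.sum_sum_Ioi_add_eq_sum_sum_off_diag]
  simp only [Finset.mul_sum, two_mul, hf]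

lemma four_mul_sin_half_sq (x : ℝ) :
    4 * Real.sin (x / 2) ^ 2 = 4 * Real.sin (x / 2) ^ 4 + Real.sin x ^ 2 := by
  have hdouble : Real.sin x = 2 * Real.sin (x / 2) * Real.cos (x / 2) := by
    rw [← Real.sin_two_mul, mul_div_cancel₀ x two_ne_zero]
  rw [hdouble]
  linear_combination (-4 * Real.sin (x / 2) ^ 2) * Real.sin_sq_add_cos_sq (x / 2)

lemma sin_half_sq_le_sq (x : ℝ) : 4 * Real.sin (x / 2) ^ 2 ≤ x ^ 2 := by
  have h : Real.sin (x / 2) ^ 2 ≤ (x / 2) ^ 2 := Real.sin_sq_le_sq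
  linarith [div_pow x 2 2]

lemma sq_le_sin_half_sq {x : ℝ} (hx : |x| ≤ Real.pi) :
    x ^ 2 ≤ Real.pi ^ 2 / 4 * (4 * Real.sin (x / 2) ^ 2) := by
  have hpi := Real.pi_pos
  have h : 2 / Real.pi * |x / 2| ≤ |Real.sin (x / 2)| :=
    Real.mul_abs_le_abs_sin (by rw [abs_div, abs_two]; linarith)
  have habs : |x| ≤ Real.pi * |Real.sin (x / 2)| := by
    rw [abs_div, abs_two, div_mul_div_comm, mul_comm Real.pi, mul_div_mul_left _ _ two_ne_zero,
      div_le_iff₀ hpi] at h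
    linarith
  have hsq := pow_le_pow_left₀ (abs_nonneg x) habs 2
  rw [mul_pow, sq_abs, sq_abs] at hsq
  linarith

section TrigonometricPolynomial

variable {d : ℕ} {P Q : Matrix (Fin d) (Fin d) ℝ}

lemma G_eq_sum_add_energyNorm_sq (hQ : Q.IsSymm) (ξ : Fin d → ℝ) :
    G Q ξ = 4 * ∑ i, energyNorm Q (Pi.single i 1) ^ 2 * Real.sin (ξ i / 2) ^ 4 +
      energyNorm Q (fun i => Real.sin (ξ i)) ^ 2 := by
  have hsymm (i j : Fin d) : (Q ^ 2) i j * Real.sin (ξ i) * Real.sin (ξ j) =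
      (Q ^ 2) j i * Real.sin (ξ j) * Real.sin (ξ i) := by
    rw [(hQ.pow 2).apply]; ring
  have hdiag : 4 * ∑ i, (Q ^ 2) i i * Real.sin (ξ i / 2) ^ 2 =
      4 * ∑ i, (Q ^ 2) i i * Real.sin (ξ i / 2) ^ 4 +
        ∑ i, (Q ^ 2) i i * Real.sin (ξ i) * Real.sin (ξ i) := by
    rw [Finset.mul_sum, Finset.mul_sum, ← Finset.sum_add_distrib]
    refine Finset.sum_congr rfl fun i _ => ?_
    linear_combination (Q ^ 2) i i * four_mul_sin_half_sq (ξ i)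
  rw [G, hdiag, energyNorm_sq_eq_sum_sum hQ, sum_sum_eq_sum_diag_add_two_mul_sum_Ioi hsymm,
    add_assoc]
  simp only [energyNorm_single_sq hQ]

lemma G_nonneg (hQ : Q.IsSymm) (ξ : Fin d → ℝ) : 0 ≤ G Q ξ := by
  rw [G_eq_sum_add_energyNorm_sq hQ]
  positivity

lemma G_le_mul_G {C : ℝ} (hP : P.IsSymm) (hQ : Q.IsSymm)
    (h : ∀ v, energyNorm P v ≤ C * energyNorm Q v) (ξ : Fin d → ℝ) :
    G P ξ ≤ C ^ 2 * G Q ξ := by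
  have hsq (v : Fin d → ℝ) : energyNorm P v ^ 2 ≤ C ^ 2 * energyNorm Q v ^ 2 := by
    rw [← mul_pow]
    exact pow_le_pow_left₀ (energyNorm_nonneg P v) (h v) 2
  rw [G_eq_sum_add_energyNorm_sq hP, G_eq_sum_add_energyNorm_sq hQ, mul_add, mul_left_comm,
    Finset.mul_sum (a := C ^ 2)]
  simp only [← mul_assoc (C ^ 2)]
  gcongr <;> exact hsq _

lemma G_one (ξ : Fin d → ℝ) : G 1 ξ = ∑ i, 4 * Real.sin (ξ i / 2) ^ 2 := by
  have hoff : ∑ i, ∑ j ∈ Finset.Ioi i, (1 : Matrix (Fin d) (Fin d) ℝ) i j * Real.sin (ξ i) *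
      Real.sin (ξ j) = 0 :=
    Finset.sum_eq_zero fun i _ => Finset.sum_eq_zero fun j hj => by
      rw [Matrix.one_apply_ne (Finset.mem_Ioi.1 hj).ne, zero_mul, zero_mul]
  rw [G, one_pow, hoff]
  simp only [Matrix.one_apply_eq, one_mul, mul_zero, add_zero, Finset.mul_sum]

lemma exists_G_le_mul_G (hP : P.IsSymm) (hQ : Q.IsSymm) (hu : IsUnit Q) :
    ∃ C : ℝ, 0 < C ∧ ∀ ξ, G P ξ ≤ C * G Q ξ := by
  obtain ⟨C, hC, h⟩ := exists_energyNorm_le_mul P hu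
  exact ⟨C ^ 2, by positivity, G_le_mul_G hP hQ h⟩

lemma exists_G_le (hQ : Q.IsSymm) : ∃ C : ℝ, ∀ ξ, G Q ξ ≤ C := by
  obtain ⟨C, hC, h⟩ := exists_G_le_mul_G hQ Matrix.isSymm_one isUnit_one
  refine ⟨C * ∑ _i : Fin d, 4, fun ξ => (h ξ).trans ?_⟩
  rw [G_one]
  gcongr
  linarith [Real.sin_sq_le_one (ξ ‹_› / 2)]

lemma exists_G_le_energyNorm_sq (hP : P.IsSymm) (hu : IsUnit Q) :
    ∃ C : ℝ, 0 < C ∧ ∀ ξ, G P ξ ≤ C * energyNorm Q ξ ^ 2 := by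
  obtain ⟨C, hC, hG⟩ := exists_G_le_mul_G hP Matrix.isSymm_one isUnit_one
  obtain ⟨K, hK, hnorm⟩ := exists_energyNorm_le_mul 1 hu
  refine ⟨C * K ^ 2, by positivity, fun ξ => (hG ξ).trans ?_⟩
  rw [mul_assoc, ← mul_pow]
  gcongr
  calc G 1 ξ ≤ ∑ i, ξ i ^ 2 := by
        rw [G_one]; exact Finset.sum_le_sum fun i _ => sin_half_sq_le_sq (ξ i)
    _ = energyNorm 1 ξ ^ 2 := (energyNorm_one_sq ξ).symm
    _ ≤ (K * energyNorm Q ξ) ^ 2 := pow_le_pow_left₀ (energyNorm_nonneg 1 ξ) (hnorm ξ) 2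

lemma exists_energyNorm_sq_le_G (P : Matrix (Fin d) (Fin d) ℝ) (hQ : Q.IsSymm) (hu : IsUnit Q) :
    ∃ C : ℝ, 0 < C ∧ ∀ ξ, ‖ξ‖ ≤ Real.pi → energyNorm P ξ ^ 2 ≤ C * G Q ξ := by
  obtain ⟨C, hC, hG⟩ := exists_G_le_mul_G Matrix.isSymm_one hQ hu
  obtain ⟨K, hK, hnorm⟩ := exists_energyNorm_le_mul P (isUnit_one (M := Matrix (Fin d) (Fin d) ℝ))
  refine ⟨K ^ 2 * (Real.pi ^ 2 / 4 * C), by positivity, fun ξ hξ => ?_⟩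
  calc energyNorm P ξ ^ 2 ≤ (K * energyNorm 1 ξ) ^ 2 :=
        pow_le_pow_left₀ (energyNorm_nonneg P ξ) (hnorm ξ) 2
    _ = K ^ 2 * ∑ i, ξ i ^ 2 := by rw [mul_pow, energyNorm_one_sq]
    _ ≤ K ^ 2 * (Real.pi ^ 2 / 4 * G 1 ξ) := by
        rw [G_one, Finset.mul_sum (a := Real.pi ^ 2 / 4)]
        gcongr with i
        exact sq_le_sin_half_sq ((norm_le_pi_norm ξ i).trans hξ)
    _ ≤ K ^ 2 * (Real.pi ^ 2 / 4 * C * G Q ξ) := by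
        rw [mul_assoc (Real.pi ^ 2 / 4)]
        gcongr
        exact hG ξ
    _ = K ^ 2 * (Real.pi ^ 2 / 4 * C) * G Q ξ := by ring

lemma G_add_latticePoint (Q : Matrix (Fin d) (Fin d) ℝ) (ξ : Fin d → ℝ) (k : Fin d → ℤ) :
    G Q (ξ + latticePoint k) = G Q ξ := by
  have hsin (i : Fin d) : Real.sin ((ξ + latticePoint k) i) = Real.sin (ξ i) := by
    rw [Pi.add_apply, latticePoint_apply, mul_comm, Real.sin_add_int_mul_two_pi]
  have hsinHalf (i : Fin d) :
      Real.sin ((ξ + latticePoint k) i / 2) ^ 2 = Real.sin (ξ i / 2) ^ 2 := by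
    have harg : (ξ + latticePoint k) i / 2 = ξ i / 2 + k i * Real.pi := by
      rw [Pi.add_apply, latticePoint_apply]; ring
    rw [harg, Real.sin_add_int_mul_pi, mul_pow]
    rcases Int.even_or_odd (k i) with h | h <;> simp [h.neg_one_zpow]
  simp only [G, hsin, hsinHalf]

lemma exists_eq_latticePoint_of_G_eq_zero (hQ : Q.IsSymm) (hu : IsUnit Q) {ξ : Fin d → ℝ}
    (h : G Q ξ = 0) : ∃ k, ξ = latticePoint k := by
  obtain ⟨ζ, k, rfl, hζ⟩ := exists_eq_add_latticePoint ξ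
  obtain ⟨C, -, hC⟩ := exists_energyNorm_sq_le_G 1 hQ hu
  have hnorm : energyNorm 1 ζ = 0 := by
    refine pow_eq_zero_iff two_ne_zero |>.1 (le_antisymm ?_ (sq_nonneg _))
    rw [← mul_zero C, ← h, G_add_latticePoint]
    exact hC ζ hζ
  exact ⟨k, by rw [(energyNorm_eq_zero isUnit_one).1 hnorm, zero_add]⟩

@[fun_prop]
lemma differentiable_G (Q : Matrix (Fin d) (Fin d) ℝ) : Differentiable ℝ (G Q) := by
  unfold G
  fun_prop

lemma exists_G_mulVec_le (M : Matrix (Fin d) (Fin d) ℝ) (hQ : Q.IsSymm) (hu : IsUnit Q) :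
    ∃ C : ℝ, 0 < C ∧ ∀ ξ, ‖ξ‖ ≤ Real.pi → G Q (M *ᵥ ξ) ≤ C * G Q ξ := by
  obtain ⟨C, hC, hupper⟩ := exists_G_le_energyNorm_sq (Q := Q) hQ hu
  obtain ⟨K, hK, hlower⟩ := exists_energyNorm_sq_le_G (Q * M) hQ hu
  refine ⟨C * K, by positivity, fun ξ hξ => (hupper _).trans ?_⟩
  rw [mul_assoc, energyNorm_mulVec]
  gcongr
  exact hlower ξ hξ

end TrigonometricPolynomial

/-! ### The dilation -/

lemma one_lt_norm_det {n K : Type*} [Fintype n] [DecidableEq n] [Nonempty n] [NormedField K]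
    [IsAlgClosed K] {M : Matrix n n K} (hM : ∀ z ∈ spectrum K M, 1 < ‖z‖) : 1 < ‖M.det‖ := by
  rw [Matrix.det_eq_prod_roots_charpoly]
  refine Multiset.prod_induction_nonempty (fun z => 1 < ‖z‖) (fun z w hz hw => ?_) ?_
    fun z hz => hM z (Matrix.mem_spectrum_of_isRoot_charpoly (Polynomial.isRoot_of_mem_roots hz))
  · rw [norm_mul]
    exact one_lt_mul_of_lt_of_le hz hw.le
  · rw [Multiset.empty_eq_zero, ← Multiset.card_pos, IsAlgClosed.card_roots_eq_natDegree,
      Matrix.charpoly_natDegree_eq_dim]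
    exact Fintype.card_pos

lemma norm_toLp_mulVec_of_mem_orthogonalGroup {n : Type*} [Fintype n] [DecidableEq n]
    {U : Matrix n n ℝ} (hU : U ∈ Matrix.orthogonalGroup n ℝ) (v : n → ℝ) :
    ‖(WithLp.toLp 2 (U *ᵥ v) : EuclideanSpace ℝ n)‖ =
      ‖(WithLp.toLp 2 v : EuclideanSpace ℝ n)‖ := by
  rw [← Matrix.toEuclideanCLM_toLp]
  exact ContinuousLinearMap.norm_map_of_mem_unitary
    (Unitary.map_mem (Matrix.toEuclideanCLM (𝕜 := ℝ)) hU) _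

section Dilation

variable {d : ℕ} {A : Matrix (Fin d) (Fin d) ℤ} {Q : Matrix (Fin d) (Fin d) ℝ}

lemma absDet_nonneg (A : Matrix (Fin d) (Fin d) ℤ) : 0 ≤ absDet A := abs_nonneg _

lemma IsDilation.one_lt_absDet (hd : 1 ≤ d) (hA : IsDilation A) : 1 < absDet A := by
  have : Nonempty (Fin d) := ⟨⟨0, hd⟩⟩
  have hdet : (complexMat A).det = ((A.det : ℝ) : ℂ) := by
    simpa using (RingHom.map_det (Int.castRingHom ℂ) A).symm
  simpa only [absDet, hdet, Complex.norm_real, Real.norm_eq_abs] using one_lt_norm_det hA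

lemma det_ne_zero_of_one_lt_absDet (h : 1 < absDet A) : A.det ≠ 0 := by
  rintro hdet
  norm_num [absDet, hdet] at h

lemma dim_pos_of_one_lt_absDet (h : 1 < absDet A) : 0 < d := by
  rcases d.eq_zero_or_pos with rfl | hd
  · norm_num [absDet] at h
  · exact hd

/-- The common modulus `q^{1/d}` of the eigenvalues of an isotropic matrix `A`, which is the ratio
of the similarity `A^T`. -/
noncomputable def dilationFactor (A : Matrix (Fin d) (Fin d) ℤ) : ℝ :=
  absDet A ^ (1 / (d : ℝ))

lemma one_lt_dilationFactor (h : 1 < absDet A) : 1 < dilationFactor A :=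
  Real.one_lt_rpow h (one_div_pos.2 (Nat.cast_pos.2 (dim_pos_of_one_lt_absDet h)))

lemma dilationFactor_rpow (A : Matrix (Fin d) (Fin d) ℤ) (x : ℝ) :
    dilationFactor A ^ x = absDet A ^ (x / d) := by
  rw [dilationFactor, ← Real.rpow_mul (absDet_nonneg A), one_div_mul_eq_div]

lemma IsSimilarityMatrix.isSymm (hQ : IsSimilarityMatrix A Q) : Q.IsSymm := by
  rw [Matrix.IsSymm, ← Matrix.conjTranspose_eq_transpose_of_trivial]
  exact hQ.1.isHermitian

lemma IsSimilarityMatrix.isUnit (hQ : IsSimilarityMatrix A Q) : IsUnit Q :=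
  hQ.1.isUnit

lemma IsSimilarityMatrix.energyNorm_invTranspose_mulVec (hQ : IsSimilarityMatrix A Q)
    (v : Fin d → ℝ) :
    energyNorm Q (invTranspose A *ᵥ v) = (dilationFactor A)⁻¹ * energyNorm Q v := by
  obtain ⟨U, hU, hA⟩ := hQ.2
  have hconj : Q *ᵥ (invTranspose A *ᵥ v) = (dilationFactor A)⁻¹ • (U *ᵥ (Q *ᵥ v)) := by
    rw [hA, Matrix.smul_mulVec, Matrix.mulVec_smul, Matrix.mulVec_mulVec, ← Matrix.mul_assoc,
      ← Matrix.mul_assoc, Matrix.mul_nonsing_inv _ ((Matrix.isUnit_iff_isUnit_det Q).1 hQ.isUnit),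
      Matrix.one_mul, Matrix.mulVec_mulVec, dilationFactor, one_div]
  have hfactor : 0 ≤ (dilationFactor A)⁻¹ := inv_nonneg.2 (Real.rpow_nonneg (absDet_nonneg A) _)
  rw [energyNorm, hconj, WithLp.toLp_smul, norm_smul, Real.norm_of_nonneg hfactor,
    norm_toLp_mulVec_of_mem_orthogonalGroup hU, energyNorm]

lemma det_realMat (A : Matrix (Fin d) (Fin d) ℤ) : (realMat A).det = A.det :=
  (RingHom.map_det (Int.castRingHom ℝ) A).symm

lemma isUnit_det_realMat (hA : A.det ≠ 0) : IsUnit (realMat A).det := by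
  rw [det_realMat]
  exact (Int.cast_ne_zero.2 hA).isUnit

lemma realMat_transpose_mul_invTranspose (hA : A.det ≠ 0) :
    realMat Aᵀ * invTranspose A = 1 := by
  rw [show realMat Aᵀ = (realMat A)ᵀ from rfl, invTranspose, ← Matrix.transpose_mul,
    Matrix.nonsing_inv_mul _ (isUnit_det_realMat hA), Matrix.transpose_one]

lemma realMat_mulVec_intVec (B : Matrix (Fin d) (Fin d) ℤ) (k : Fin d → ℤ) :
    realMat B *ᵥ intVec k = intVec (B *ᵥ k) :=
  funext fun i => (RingHom.map_mulVec (Int.castRingHom ℝ) B k i).symm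

lemma realMat_mulVec_latticePoint (B : Matrix (Fin d) (Fin d) ℤ) (k : Fin d → ℤ) :
    realMat B *ᵥ latticePoint k = latticePoint (B *ᵥ k) := by
  rw [latticePoint, Matrix.mulVec_smul, realMat_mulVec_intVec, latticePoint]

end Dilation

/-! ### Iterated infinite products -/

section IteratedProduct

variable {X R : Type*} {T : X → X} {N : X → ℝ} {r : ℝ}

lemma apply_iterate_le (hr : 0 ≤ r) (hT : ∀ x, N (T x) ≤ r * N x) (n : ℕ) (x : X) :
    N (T^[n] x) ≤ r ^ n * N x := by
  induction n with
  | zero => simp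
  | succ n ih =>
    calc N (T^[n + 1] x) ≤ r * N (T^[n] x) := by
          rw [Function.iterate_succ_apply']; exact hT _
      _ ≤ r * (r ^ n * N x) := by gcongr
      _ = r ^ (n + 1) * N x := by ring

variable [NormedCommRing R] {m : X → R}

/-- The infinite product `m(T x) m(T² x) m(T³ x) ⋯`. -/
noncomputable def iteratedProduct (m : X → R) (T : X → X) (x : X) : R :=
  ∏' n : ℕ, m (T^[n + 1] x)

lemma iteratedProduct_eq_tprod_one_add (m : X → R) (T : X → X) (x : X) :
    iteratedProduct m T x = ∏' n : ℕ, (1 + (m (T^[n + 1] x) - 1)) := by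
  simp only [iteratedProduct, add_sub_cancel]

lemma norm_apply_iterate_sub_one_le (hr : 0 ≤ r) (hm : ∀ x, ‖m x - 1‖ ≤ N x)
    (hT : ∀ x, N (T x) ≤ r * N x) (n : ℕ) (x : X) :
    ‖m (T^[n + 1] x) - 1‖ ≤ r ^ n * (r * N x) :=
  (hm _).trans ((apply_iterate_le hr hT (n + 1) x).trans_eq (by ring))

lemma summable_norm_apply_iterate_sub_one (hr : 0 ≤ r) (hr1 : r < 1)
    (hm : ∀ x, ‖m x - 1‖ ≤ N x) (hT : ∀ x, N (T x) ≤ r * N x) (x : X) :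
    Summable fun n : ℕ => ‖m (T^[n + 1] x) - 1‖ :=
  ((summable_geometric_of_lt_one hr hr1).mul_right _).of_nonneg_of_le (fun _ => norm_nonneg _)
    fun n => norm_apply_iterate_sub_one_le hr hm hT n x

variable [NormOneClass R] [CompleteSpace R]

lemma iteratedProduct_eq_mul (hr : 0 ≤ r) (hr1 : r < 1) (hm : ∀ x, ‖m x - 1‖ ≤ N x)
    (hT : ∀ x, N (T x) ≤ r * N x) (x : X) :
    iteratedProduct m T x = m (T x) * iteratedProduct m T (T x) := by
  have hmul : Multipliable fun n : ℕ => m (T^[n + 1] (T x)) := by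
    simpa only [add_sub_cancel] using
      multipliable_one_add_of_summable (summable_norm_apply_iterate_sub_one hr hr1 hm hT (T x))
  simp only [← Function.iterate_succ_apply] at hmul
  exact tprod_eq_zero_mul' hmul

lemma iteratedProduct_ne_zero [NormMulClass R] (hr : 0 ≤ r) (hr1 : r < 1)
    (hm : ∀ x, ‖m x - 1‖ ≤ N x) (hT : ∀ x, N (T x) ≤ r * N x) {x : X}
    (h0 : ∀ n : ℕ, m (T^[n + 1] x) ≠ 0) : iteratedProduct m T x ≠ 0 := by
  rw [iteratedProduct_eq_tprod_one_add]
  refine tprod_one_add_ne_zero_of_summable (fun n => ?_)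
    (summable_norm_apply_iterate_sub_one hr hr1 hm hT x)
  rw [add_sub_cancel]
  exact h0 n

lemma continuous_iteratedProduct [TopologicalSpace X] (hmc : Continuous m) (hTc : Continuous T)
    (hNc : Continuous N) (hr : 0 ≤ r) (hr1 : r < 1) (hm : ∀ x, ‖m x - 1‖ ≤ N x)
    (hT : ∀ x, N (T x) ≤ r * N x) : Continuous (iteratedProduct m T) := by
  refine continuous_iff_continuousAt.2 fun x => ?_
  have hbound : ∀ᶠ y in nhds x, N y < N x + 1 :=
    hNc.continuousAt.eventually_lt_const (lt_add_one _)
  rw [ContinuousAt, funext (iteratedProduct_eq_tprod_one_add m T)]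
  refine tendsto_tprod_one_add_of_dominated_convergence
    (bound := fun n => r ^ n * (r * (N x + 1))) ((summable_geometric_of_lt_one hr hr1).mul_right _)
    (fun n => ?_) ?_
  · exact ((hmc.comp (hTc.iterate (n + 1))).sub continuous_const).tendsto x
  · filter_upwards [hbound] with y hy n
    refine (norm_apply_iterate_sub_one_le hr hm hT n y).trans ?_
    gcongr

end IteratedProduct

section Decay

variable {X : Type*} {T : X → X} {m φ g N : X → ℝ}

lemma mul_apply_iterate_le {κ : ℝ} (hκ : 0 ≤ κ) (hm : ∀ x, 0 ≤ m x) (hφ : ∀ x, 0 ≤ φ x)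
    (href : ∀ x, φ x = m (T x) * φ (T x)) (hg : ∀ x, m (T x) * g (T x) ≤ κ * g x) (n : ℕ) (x : X) :
    φ x * g (T^[n] x) ≤ κ ^ n * g x * φ (T^[n] x) := by
  induction n generalizing x with
  | zero => simp [mul_comm]
  | succ n ih =>
    rw [Function.iterate_succ_apply]
    calc φ x * g (T^[n] (T x)) = m (T x) * (φ (T x) * g (T^[n] (T x))) := by rw [href x, mul_assoc]
      _ ≤ m (T x) * (κ ^ n * g (T x) * φ (T^[n] (T x))) :=
          mul_le_mul_of_nonneg_left (ih (T x)) (hm _)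
      _ = κ ^ n * φ (T^[n] (T x)) * (m (T x) * g (T x)) := by ring
      _ ≤ κ ^ n * φ (T^[n] (T x)) * (κ * g x) :=
          mul_le_mul_of_nonneg_left (hg x) (mul_nonneg (pow_nonneg hκ n) (hφ _))
      _ = κ ^ (n + 1) * g x * φ (T^[n] (T x)) := by ring

lemma exists_iterate_mem_fundamental_annulus {ρ : ℝ} (hρ : 1 < ρ)
    (hNT : ∀ x, N (T x) = ρ⁻¹ * N x) {x : X} (hx : 1 ≤ N x) :
    ∃ n : ℕ, N x ≤ ρ ^ (n + 1) ∧ 1 ≤ N (T^[n] x) ∧ N (T^[n] x) ≤ ρ := by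
  have : 0 < ρ := one_pos.trans hρ
  have hiter (n : ℕ) : N (T^[n] x) = N x / ρ ^ n := by
    induction n with
    | zero => simp
    | succ n ih => rw [Function.iterate_succ_apply', hNT, ih, pow_succ]; field_simp
  obtain ⟨n, hn, hn'⟩ := exists_nat_pow_near hx hρ
  refine ⟨n, hn'.le, ?_, ?_⟩
  · rwa [hiter, one_le_div (by positivity)]
  · rw [hiter, div_le_iff₀ (by positivity), ← pow_succ']
    exact hn'.le

lemma rpow_neg_le_mul_rpow_neg {a b c σ : ℝ} (ha : 0 < a) (hc : 0 < c) (hσ : 0 ≤ σ)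
    (h : a ≤ c * b) : b ^ (-σ) ≤ c ^ σ * a ^ (-σ) := by
  have hb : 0 < b := pos_of_mul_pos_right (ha.trans_le h) hc.le
  calc b ^ (-σ) = c ^ σ * (c * b) ^ (-σ) := by
        rw [Real.mul_rpow hc.le hb.le, Real.rpow_neg hc.le, mul_inv_cancel_left₀ (by positivity)]
    _ ≤ c ^ σ * a ^ (-σ) := by
        gcongr ?_ * ?_
        exact Real.rpow_le_rpow_of_nonpos ha h (neg_nonpos.2 hσ)

lemma exists_le_mul_one_add_rpow_neg {ρ σ δ M P : ℝ} (hρ : 1 < ρ) (hσ : 0 ≤ σ) (hδ : 0 < δ)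
    (hN : ∀ x, 0 ≤ N x) (hNT : ∀ x, N (T x) = ρ⁻¹ * N x) (hm : ∀ x, 0 ≤ m x) (hφ : ∀ x, 0 ≤ φ x)
    (href : ∀ x, φ x = m (T x) * φ (T x)) (hg : ∀ x, m (T x) * g (T x) ≤ ρ ^ (-σ) * g x)
    (hgM : ∀ x, g x ≤ M) (hgδ : ∀ x, 1 ≤ N x → N x ≤ ρ → δ ≤ g x) (hφP : ∀ x, N x ≤ ρ → φ x ≤ P) :
    ∃ C : ℝ, ∀ x, φ x ≤ C * (1 + N x) ^ (-σ) := by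
  have hρ0 : 0 < ρ := one_pos.trans hρ
  suffices h : ∀ x, ∃ n : ℕ, 1 + N x ≤ 2 * ρ * ρ ^ n ∧
      φ x ≤ max P (M * P / δ) * (ρ ^ n) ^ (-σ) by
    refine ⟨max P (M * P / δ) * (2 * ρ) ^ σ, fun x => ?_⟩
    obtain ⟨n, hn, hx⟩ := h x
    have hmax : 0 ≤ max P (M * P / δ) :=
      nonneg_of_mul_nonneg_left ((hφ x).trans hx) (by positivity)
    refine hx.trans ?_
    rw [mul_assoc]
    gcongr
    exact rpow_neg_le_mul_rpow_neg (by linarith [hN x]) (by positivity) hσ hn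
  intro x
  rcases lt_or_ge (N x) 1 with hx | hx
  · refine ⟨0, by linarith, ?_⟩
    simpa using Or.inl (hφP x (hx.le.trans hρ.le))
  obtain ⟨n, hn, hge, hle⟩ := exists_iterate_mem_fundamental_annulus hρ hNT hx
  have hκ : (ρ ^ (-σ)) ^ n = (ρ ^ n) ^ (-σ) := by
    rw [← Real.rpow_mul_natCast hρ0.le, mul_comm, Real.rpow_natCast_mul hρ0.le]
  refine ⟨n, by rw [mul_assoc, ← pow_succ']; linarith, ?_⟩
  have hM : 0 ≤ M := hδ.le.trans ((hgδ _ hge hle).trans (hgM _))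
  have hφδ : φ x * δ ≤ M * P * (ρ ^ n) ^ (-σ) :=
    calc φ x * δ ≤ φ x * g (T^[n] x) := mul_le_mul_of_nonneg_left (hgδ _ hge hle) (hφ x)
      _ ≤ (ρ ^ (-σ)) ^ n * g x * φ (T^[n] x) :=
          mul_apply_iterate_le (by positivity) hm hφ href hg n x
      _ ≤ (ρ ^ (-σ)) ^ n * M * P := by
          have := hφ (T^[n] x)
          gcongr
          · exact hgM x
          · exact hφP _ hle
      _ = M * P * (ρ ^ n) ^ (-σ) := by rw [hκ]; ring
  calc φ x ≤ M * P / δ * (ρ ^ n) ^ (-σ) := by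
        rw [div_mul_eq_mul_div]; exact (le_div_iff₀ hδ).2 hφδ
    _ ≤ max P (M * P / δ) * (ρ ^ n) ^ (-σ) := by gcongr; exact le_max_right _ _

end Decay

/-! ### Digits and the mask -/

lemma exists_norm_sub_le_of_differentiableAt {𝕜 E F : Type*} [NontriviallyNormedField 𝕜]
    [NormedAddCommGroup E] [NormedSpace 𝕜 E] [NormedAddCommGroup F] [NormedSpace 𝕜 F] {f : E → F}
    {a : E} {M : ℝ} (hf : DifferentiableAt 𝕜 f a) (hM : ∀ x, ‖f x‖ ≤ M) :
    ∃ C : ℝ, 0 < C ∧ ∀ x, ‖f x - f a‖ ≤ C * ‖x - a‖ := by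
  obtain ⟨c, hc, hbound⟩ := hf.isBigO_sub.exists_pos
  obtain ⟨δ, hδ, hball⟩ := Metric.eventually_nhds_iff.1 hbound.bound
  refine ⟨max c (2 * M / δ), lt_max_of_lt_left hc, fun x => ?_⟩
  rcases lt_or_ge ‖x - a‖ δ with hx | hx
  · refine (hball (by rwa [dist_eq_norm])).trans ?_
    gcongr
    exact le_max_left _ _
  · have : 0 ≤ M := (norm_nonneg _).trans (hM a)
    calc ‖f x - f a‖ ≤ 2 * M := by linarith [norm_sub_le (f x) (f a), hM x, hM a]
      _ = 2 * M / δ * δ := (div_mul_cancel₀ _ hδ.ne').symm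
      _ ≤ max c (2 * M / δ) * ‖x - a‖ := by
        gcongr
        exact le_max_right _ _

section Digits

variable {d : ℕ} {A B : Matrix (Fin d) (Fin d) ℤ} {Q : Matrix (Fin d) (Fin d) ℝ}

lemma finite_digitPoints (hB : B.det ≠ 0) : (digitPoints B).Finite := by
  have hinj : Function.Injective (realMat B).mulVec :=
    Matrix.mulVec_injective_of_isUnit ((Matrix.isUnit_iff_isUnit_det _).2 (isUnit_det_realMat hB))
  obtain ⟨R, hR⟩ := ((isCompact_Icc (a := (0 : Fin d → ℝ)) (b := 1)).image
    (f := (realMat B).mulVec) (by fun_prop)).isBounded.exists_norm_le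
  have hball : (Metric.closedBall (0 : Fin d → ℤ) R).Finite :=
    isCompact_iff_finite.1 (isCompact_closedBall 0 R)
  refine Set.Finite.of_finite_image ((hball.image intVec).subset ?_) hinj.injOn
  rintro _ ⟨s, ⟨hs, n, hn⟩, rfl⟩
  have hnorm : ‖intVec n‖ ≤ R := by
    rw [show intVec n = realMat B *ᵥ s from hn.symm]
    exact hR _ ⟨s, ⟨fun i => (hs i).1, fun i => (hs i).2.le⟩, rfl⟩
  refine ⟨n, ?_, hn.symm⟩
  rw [mem_closedBall_zero_iff]
  refine (pi_norm_le_iff_of_nonneg ((norm_nonneg _).trans hnorm)).2 fun i => ?_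
  simpa only [Int.norm_cast_real] using (norm_le_pi_norm _ i).trans hnorm

lemma fract_mem_digitPoints {v : Fin d → ℝ} {n : Fin d → ℤ} (h : realMat B *ᵥ v = intVec n) :
    (fun i => Int.fract (v i)) ∈ digitPoints B := by
  refine ⟨fun i => ⟨Int.fract_nonneg _, Int.fract_lt_one _⟩, n - B *ᵥ fun i => ⌊v i⌋, ?_⟩
  have hfract : (fun i => Int.fract (v i)) = v - intVec fun i => ⌊v i⌋ := rfl
  rw [hfract, Matrix.mulVec_sub, h, realMat_mulVec_intVec]
  ext i
  simp

lemma eq_zero_of_intVec_mem_digitPoints {k : Fin d → ℤ} (hk : intVec k ∈ digitPoints B) :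
    k = 0 := by
  ext i
  obtain ⟨h0, h1⟩ := hk.1 i
  exact le_antisymm (Int.lt_add_one_iff.1 (Int.cast_lt.1 (h1.trans_eq Int.cast_one.symm)))
    (Int.cast_nonneg_iff.1 h0)

lemma G_two_pi_smul_pos (hQ : Q.IsSymm) (hu : IsUnit Q) {s : Fin d → ℝ} (hs : s ∈ digitPoints B)
    (hs0 : s ≠ 0) : 0 < G Q ((2 * Real.pi) • s) := by
  refine (G_nonneg hQ _).lt_of_ne' fun hG => hs0 ?_
  obtain ⟨k, hk⟩ := exists_eq_latticePoint_of_G_eq_zero hQ hu hG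
  obtain rfl : s = intVec k := smul_right_injective _ Real.two_pi_pos.ne' hk
  rw [eq_zero_of_intVec_mem_digitPoints hs]
  ext i
  simp

/-- The set `S \ {0}` that indexes the factors of the mask, as a finite set. -/
noncomputable def nonzeroDigits (hA : A.det ≠ 0) : Finset (Fin d → ℝ) :=
  ((finite_digitPoints (B := Aᵀ) (by rwa [Matrix.det_transpose])).sdiff (t := {0})).toFinset

lemma mem_nonzeroDigits (hA : A.det ≠ 0) {s : Fin d → ℝ} :
    s ∈ nonzeroDigits hA ↔ s ∈ digitPoints Aᵀ ∧ s ≠ 0 := by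
  simp [nonzeroDigits]

/-- The numerator of the mask. Its value at `0` is the denominator. -/
noncomputable def maskNumerator (hA : A.det ≠ 0) (Q : Matrix (Fin d) (Fin d) ℝ)
    (ξ : Fin d → ℝ) : ℝ :=
  ∏ s ∈ nonzeroDigits hA, G Q (ξ + (2 * Real.pi) • s)

lemma mask_eq_div (hA : A.det ≠ 0) (Q : Matrix (Fin d) (Fin d) ℝ) (ξ : Fin d → ℝ) :
    mask A Q ξ = maskNumerator hA Q ξ / maskNumerator hA Q 0 := by
  simp only [mask, maskNumerator, nonzeroDigits, zero_add]
  rw [finprod_mem_eq_finite_toFinset_prod, finprod_mem_eq_finite_toFinset_prod]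

lemma maskNumerator_nonneg (hA : A.det ≠ 0) (hQ : Q.IsSymm) (ξ : Fin d → ℝ) :
    0 ≤ maskNumerator hA Q ξ :=
  Finset.prod_nonneg fun _ _ => G_nonneg hQ _

lemma maskNumerator_zero_pos (hA : A.det ≠ 0) (hQ : Q.IsSymm) (hu : IsUnit Q) :
    0 < maskNumerator hA Q 0 := by
  refine Finset.prod_pos fun s hs => ?_
  obtain ⟨hs, hs0⟩ := (mem_nonzeroDigits hA).1 hs
  rw [zero_add]
  exact G_two_pi_smul_pos hQ hu hs hs0

lemma mask_nonneg (hA : A.det ≠ 0) (hQ : Q.IsSymm) (ξ : Fin d → ℝ) : 0 ≤ mask A Q ξ := by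
  rw [mask_eq_div hA]
  exact div_nonneg (maskNumerator_nonneg hA hQ ξ) (maskNumerator_nonneg hA hQ 0)

lemma mask_zero (hA : A.det ≠ 0) (hQ : Q.IsSymm) (hu : IsUnit Q) : mask A Q 0 = 1 := by
  rw [mask_eq_div hA, div_self (maskNumerator_zero_pos hA hQ hu).ne']

lemma differentiable_mask (hA : A.det ≠ 0) (Q : Matrix (Fin d) (Fin d) ℝ) :
    Differentiable ℝ (mask A Q) := by
  have hnum : Differentiable ℝ (maskNumerator hA Q) := fun ξ =>
    (HasFDerivAt.finsetProd fun s _ => ((differentiable_G Q).comp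
      (differentiable_id.add_const ((2 * Real.pi) • s)) ξ).hasFDerivAt).differentiableAt
  rw [funext (mask_eq_div hA Q)]
  simp only [div_eq_mul_inv]
  exact hnum.mul_const _

lemma exists_mask_le (hA : A.det ≠ 0) (hQ : Q.IsSymm) : ∃ C : ℝ, ∀ ξ, mask A Q ξ ≤ C := by
  obtain ⟨C, hG⟩ := exists_G_le hQ
  refine ⟨C ^ (nonzeroDigits hA).card / maskNumerator hA Q 0, fun ξ => ?_⟩
  rw [mask_eq_div hA]
  refine div_le_div_of_nonneg_right ?_ (maskNumerator_nonneg hA hQ 0)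
  exact (Finset.prod_le_prod (fun _ _ => G_nonneg hQ _) fun _ _ => hG _).trans_eq
    (Finset.prod_const _)

lemma exists_norm_mask_sub_one_le (hA : A.det ≠ 0) (hQ : Q.IsSymm) (hu : IsUnit Q) :
    ∃ C : ℝ, ∀ ξ, ‖mask A Q ξ - 1‖ ≤ C * energyNorm Q ξ := by
  obtain ⟨M, hM⟩ := exists_mask_le hA hQ
  obtain ⟨C, hC, hlip⟩ := exists_norm_sub_le_of_differentiableAt (differentiable_mask hA Q 0)
    fun ξ => (Real.norm_of_nonneg (mask_nonneg hA hQ ξ)).trans_le (hM ξ)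
  obtain ⟨K, -, hnorm⟩ := exists_energyNorm_le_mul 1 hu
  refine ⟨C * K, fun ξ => ?_⟩
  rw [← mask_zero hA hQ hu, mul_assoc]
  refine (hlip ξ).trans ?_
  rw [sub_zero]
  gcongr
  exact (norm_le_energyNorm_one ξ).trans (hnorm ξ)

lemma exists_realMat_mulVec_eq_latticePoint_of_mask_eq_zero (hA : A.det ≠ 0) (hQ : Q.IsSymm)
    (hu : IsUnit Q) {ξ : Fin d → ℝ} (h : mask A Q ξ = 0) :
    ∃ k, realMat Aᵀ *ᵥ ξ = latticePoint k := by
  rw [mask_eq_div hA, div_eq_zero_iff, or_iff_left (maskNumerator_zero_pos hA hQ hu).ne',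
    maskNumerator, Finset.prod_eq_zero_iff] at h
  obtain ⟨s, hs, hG⟩ := h
  obtain ⟨n, hn⟩ := ((mem_nonzeroDigits hA).1 hs).1.2
  obtain ⟨k, hk⟩ := exists_eq_latticePoint_of_G_eq_zero hQ hu hG
  refine ⟨Aᵀ *ᵥ k - n, ?_⟩
  rw [eq_sub_of_add_eq hk, Matrix.mulVec_sub, realMat_mulVec_latticePoint, Matrix.mulVec_smul, hn]
  ext i
  simp [latticePoint, intVec, mul_sub]

/-! ### The function `μ` -/

-- If `ξ = ζ + 2πk` with `|ζ| ≤ π`, then the digit `s` of `-A^{-T}k` moves `A^{-T}ξ` to `A^{-T}ζ`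
-- modulo the lattice.
lemma exists_digit_G_le (hA : A.det ≠ 0) (hQ : Q.IsSymm) (hu : IsUnit Q) :
    ∃ C : ℝ, 0 < C ∧ ∀ ξ, ∃ s ∈ digitPoints Aᵀ,
      G Q (invTranspose A *ᵥ ξ + (2 * Real.pi) • s) ≤ C * G Q ξ := by
  obtain ⟨C, hC, hG⟩ := exists_G_mulVec_le (invTranspose A) hQ hu
  refine ⟨C, hC, fun ξ => ?_⟩
  obtain ⟨ζ, k, rfl, hζ⟩ := exists_eq_add_latticePoint ξ
  set v : Fin d → ℝ := -(invTranspose A *ᵥ intVec k) with hv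
  have hint : realMat Aᵀ *ᵥ v = intVec (-k) := by
    rw [hv, Matrix.mulVec_neg, Matrix.mulVec_mulVec, realMat_transpose_mul_invTranspose hA,
      Matrix.one_mulVec]
    ext i
    simp [intVec]
  refine ⟨fun i => Int.fract (v i), fract_mem_digitPoints hint, ?_⟩
  have hshift : invTranspose A *ᵥ (ζ + latticePoint k) + (2 * Real.pi) • (fun i => Int.fract (v i))
      = invTranspose A *ᵥ ζ + latticePoint fun i => -⌊v i⌋ := by
    rw [Matrix.mulVec_add, latticePoint, Matrix.mulVec_smul, ← neg_eq_iff_eq_neg.2 hv, add_assoc,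
      ← smul_add, latticePoint]
    congr 2
    ext i
    simp [intVec, Int.fract, -Int.self_sub_floor]
    ring
  rw [hshift, G_add_latticePoint, G_add_latticePoint]
  exact hG ζ hζ

lemma exists_mask_mul_G_le (hA : A.det ≠ 0) (hQ : Q.IsSymm) (hu : IsUnit Q) :
    ∃ C : ℝ, ∀ ξ, mask A Q (invTranspose A *ᵥ ξ) * G Q (invTranspose A *ᵥ ξ) ≤ C * G Q ξ := by
  classical
  obtain ⟨M, hM⟩ := exists_G_le hQ
  obtain ⟨C, hC, hdigit⟩ := exists_digit_G_le hA hQ hu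
  have h0 : (0 : Fin d → ℝ) ∉ nonzeroDigits hA := by simp [mem_nonzeroDigits hA]
  set S := insert 0 (nonzeroDigits hA)
  refine ⟨C * M ^ (S.card - 1) / maskNumerator hA Q 0, fun ξ => ?_⟩
  obtain ⟨s, hs, hGs⟩ := hdigit ξ
  have hsS : s ∈ S := by
    by_cases hs0 : s = 0
    · exact hs0 ▸ Finset.mem_insert_self _ _
    · exact Finset.mem_insert_of_mem ((mem_nonzeroDigits hA).2 ⟨hs, hs0⟩)
  set η := invTranspose A *ᵥ ξ
  have hprod : maskNumerator hA Q η * G Q η = ∏ s ∈ S, G Q (η + (2 * Real.pi) • s) := by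
    rw [Finset.prod_insert h0, smul_zero, add_zero, mul_comm, maskNumerator]
  rw [mask_eq_div hA, div_mul_eq_mul_div, div_mul_eq_mul_div, hprod]
  refine div_le_div_of_nonneg_right ?_ (maskNumerator_nonneg hA hQ 0)
  calc ∏ s ∈ S, G Q (η + (2 * Real.pi) • s)
      = G Q (η + (2 * Real.pi) • s) * ∏ t ∈ S.erase s, G Q (η + (2 * Real.pi) • t) :=
        (Finset.mul_prod_erase _ _ hsS).symm
    _ ≤ C * G Q ξ * ∏ _t ∈ S.erase s, M :=
        mul_le_mul hGs (Finset.prod_le_prod (fun _ _ => G_nonneg hQ _) fun _ _ => hM _)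
          (Finset.prod_nonneg fun _ _ => G_nonneg hQ _) (mul_nonneg hC.le (G_nonneg hQ ξ))
    _ = C * M ^ (S.card - 1) * G Q ξ := by
        rw [Finset.prod_const, Finset.card_erase_of_mem hsS]; ring

lemma bddAbove_range_mu (hA : A.det ≠ 0) (hQ : Q.IsSymm) (hu : IsUnit Q) :
    BddAbove (Set.range (mu A Q)) := by
  obtain ⟨C, hC⟩ := exists_mask_mul_G_le hA hQ hu
  refine ⟨max 1 (absDet A ^ (2 / (d : ℝ)) * C), ?_⟩
  rintro _ ⟨ξ, rfl⟩
  rw [mu]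
  split_ifs with h0
  · exact le_max_left _ _
  · refine le_max_of_le_right ?_
    rw [div_le_iff₀ ((G_nonneg hQ ξ).lt_of_ne' h0), mul_assoc, mul_assoc]
    exact mul_le_mul_of_nonneg_left (hC ξ) (Real.rpow_nonneg (absDet_nonneg A) _)

lemma mask_mul_G_le_supMu_div_mul (hA : A.det ≠ 0) (hQ : Q.IsSymm) (hu : IsUnit Q)
    (ξ : Fin d → ℝ) :
    mask A Q (invTranspose A *ᵥ ξ) * G Q (invTranspose A *ᵥ ξ) ≤
      supMu A Q / absDet A ^ (2 / (d : ℝ)) * G Q ξ := by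
  rcases (G_nonneg hQ ξ).eq_or_lt with h0 | hpos
  · obtain ⟨C, hC⟩ := exists_mask_mul_G_le hA hQ hu
    simpa only [← h0, mul_zero] using hC ξ
  · have hq : 0 < absDet A ^ (2 / (d : ℝ)) :=
      Real.rpow_pos_of_pos (abs_pos.2 (Int.cast_ne_zero.2 hA)) _
    have hmu : mu A Q ξ ≤ supMu A Q := le_ciSup (bddAbove_range_mu hA hQ hu) ξ
    rw [mu, if_neg hpos.ne', div_le_iff₀ hpos, mul_assoc] at hmu
    rw [div_mul_eq_mul_div, le_div_iff₀ hq, mul_comm]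
    exact hmu

end Digits

/-! ### The function `φ̂` -/

section PhiHat

variable {d : ℕ} {A : Matrix (Fin d) (Fin d) ℤ} {Q : Matrix (Fin d) (Fin d) ℝ}

lemma mulVec_iterate {n R : Type*} [Fintype n] [DecidableEq n] [Semiring R] (M : Matrix n n R)
    (k : ℕ) (v : n → R) : M.mulVec^[k] v = M ^ k *ᵥ v := by
  induction k with
  | zero => simp
  | succ k ih => rw [Function.iterate_succ_apply', ih, Matrix.mulVec_mulVec, pow_succ']

lemma phiHat_eq_iteratedProduct (A : Matrix (Fin d) (Fin d) ℤ) (Q : Matrix (Fin d) (Fin d) ℝ) :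
    phiHat A Q = iteratedProduct (mask A Q) (invTranspose A).mulVec := by
  funext ξ
  simp only [iteratedProduct, mulVec_iterate, phiHat]

lemma exists_continuous_majorant_mask (hA : 1 < absDet A) (hQ : IsSimilarityMatrix A Q) :
    ∃ N : (Fin d → ℝ) → ℝ, Continuous N ∧ (∀ ξ, ‖mask A Q ξ - 1‖ ≤ N ξ) ∧
      ∀ ξ, N (invTranspose A *ᵥ ξ) ≤ (dilationFactor A)⁻¹ * N ξ := by
  obtain ⟨C, hC⟩ :=
    exists_norm_mask_sub_one_le (det_ne_zero_of_one_lt_absDet hA) hQ.isSymm hQ.isUnit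
  refine ⟨fun ξ => C * energyNorm Q ξ, by fun_prop, hC, fun ξ => ?_⟩
  simp only [hQ.energyNorm_invTranspose_mulVec, mul_left_comm, le_refl]

lemma inv_dilationFactor_mem_Ico (hA : 1 < absDet A) :
    (dilationFactor A)⁻¹ ∈ Set.Ico (0 : ℝ) 1 :=
  ⟨inv_nonneg.2 (Real.rpow_nonneg (absDet_nonneg A) _),
    inv_lt_one_of_one_lt₀ (one_lt_dilationFactor hA)⟩

lemma phiHat_eq_mask_mul_phiHat (hA : 1 < absDet A) (hQ : IsSimilarityMatrix A Q)
    (ξ : Fin d → ℝ) :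
    phiHat A Q ξ = mask A Q (invTranspose A *ᵥ ξ) * phiHat A Q (invTranspose A *ᵥ ξ) := by
  obtain ⟨N, -, hm, hT⟩ := exists_continuous_majorant_mask hA hQ
  obtain ⟨hr, hr1⟩ := inv_dilationFactor_mem_Ico hA
  rw [phiHat_eq_iteratedProduct]
  exact iteratedProduct_eq_mul hr hr1 hm hT ξ

lemma continuous_phiHat (hA : 1 < absDet A) (hQ : IsSimilarityMatrix A Q) :
    Continuous (phiHat A Q) := by
  obtain ⟨N, hN, hm, hT⟩ := exists_continuous_majorant_mask hA hQ
  obtain ⟨hr, hr1⟩ := inv_dilationFactor_mem_Ico hA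
  have hmask : Continuous (mask A Q) :=
    (differentiable_mask (det_ne_zero_of_one_lt_absDet hA) Q).continuous
  rw [phiHat_eq_iteratedProduct]
  exact continuous_iteratedProduct hmask (by fun_prop) hN hr hr1 hm hT

lemma phiHat_nonneg (hA : A.det ≠ 0) (hQ : Q.IsSymm) (ξ : Fin d → ℝ) : 0 ≤ phiHat A Q ξ :=
  tprod_nonneg fun _ => mask_nonneg hA hQ _

lemma phiHat_zero (hA : A.det ≠ 0) (hQ : Q.IsSymm) (hu : IsUnit Q) : phiHat A Q 0 = 1 := by
  simp only [phiHat, Matrix.mulVec_zero, mask_zero hA hQ hu, tprod_one]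

lemma exists_eq_latticePoint_of_iterate_eq (hA : A.det ≠ 0) {n : ℕ} {ξ : Fin d → ℝ}
    {k : Fin d → ℤ} (h : (invTranspose A).mulVec^[n] ξ = latticePoint k) :
    ∃ l, ξ = latticePoint l := by
  induction n generalizing ξ with
  | zero => exact ⟨k, h⟩
  | succ n ih =>
    obtain ⟨l, hl⟩ := ih h
    refine ⟨Aᵀ *ᵥ l, ?_⟩
    rw [← realMat_mulVec_latticePoint, ← hl, Matrix.mulVec_mulVec,
      realMat_transpose_mul_invTranspose hA, Matrix.one_mulVec]

lemma exists_eq_latticePoint_of_phiHat_eq_zero (hA : 1 < absDet A) (hQ : IsSimilarityMatrix A Q)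
    {ξ : Fin d → ℝ} (h : phiHat A Q ξ = 0) : ∃ k, ξ = latticePoint k := by
  have hdet := det_ne_zero_of_one_lt_absDet hA
  obtain ⟨N, -, hm, hT⟩ := exists_continuous_majorant_mask hA hQ
  obtain ⟨hr, hr1⟩ := inv_dilationFactor_mem_Ico hA
  contrapose! h
  rw [phiHat_eq_iteratedProduct]
  refine iteratedProduct_ne_zero hr hr1 hm hT fun n hn => ?_
  obtain ⟨k, hk⟩ :=
    exists_realMat_mulVec_eq_latticePoint_of_mask_eq_zero hdet hQ.isSymm hQ.isUnit hn
  rw [Function.iterate_succ_apply', Matrix.mulVec_mulVec, realMat_transpose_mul_invTranspose hdet,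
    Matrix.one_mulVec] at hk
  obtain ⟨l, hl⟩ := exists_eq_latticePoint_of_iterate_eq hdet hk
  exact h l hl

lemma exists_pos_le_phiHat (hA : 1 < absDet A) (hQ : IsSimilarityMatrix A Q) :
    ∃ a : ℝ, 0 < a ∧ ∀ ξ, ‖ξ‖ ≤ Real.pi → a ≤ phiHat A Q ξ := by
  have hdet := det_ne_zero_of_one_lt_absDet hA
  obtain ⟨ζ, hζ, hmin⟩ := (isCompact_closedBall (0 : Fin d → ℝ) Real.pi).exists_isMinOn
    ⟨0, by simpa using Real.pi_pos.le⟩ (continuous_phiHat hA hQ).continuousOn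
  refine ⟨phiHat A Q ζ, ?_, fun ξ hξ => hmin (by simpa using hξ)⟩
  refine (phiHat_nonneg hdet hQ.isSymm ζ).lt_of_ne' fun h => ?_
  obtain ⟨k, rfl⟩ := exists_eq_latticePoint_of_phiHat_eq_zero hA hQ h
  rw [eq_zero_of_norm_latticePoint_le_pi (mem_closedBall_zero_iff.1 hζ), latticePoint_zero,
    phiHat_zero hdet hQ.isSymm hQ.isUnit] at h
  exact one_ne_zero h

lemma mask_mul_G_le_rpow_mul (hA : 1 < absDet A) (hQ : IsSimilarityMatrix A Q) {σ : ℝ}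
    (hB : supMu A Q ≤ dilationFactor A ^ (2 - σ)) (ξ : Fin d → ℝ) :
    mask A Q (invTranspose A *ᵥ ξ) * G Q (invTranspose A *ᵥ ξ) ≤
      dilationFactor A ^ (-σ) * G Q ξ := by
  have hρ : 0 < dilationFactor A := one_pos.trans (one_lt_dilationFactor hA)
  refine (mask_mul_G_le_supMu_div_mul (det_ne_zero_of_one_lt_absDet hA) hQ.isSymm hQ.isUnit
    ξ).trans (mul_le_mul_of_nonneg_right ?_ (G_nonneg hQ.isSymm ξ))
  rw [← dilationFactor_rpow, div_le_iff₀ (Real.rpow_pos_of_pos hρ _), ← Real.rpow_add hρ,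
    neg_add_eq_sub]
  exact hB

lemma exists_phiHat_le_mul_rpow_neg (hA : 1 < absDet A) (hQ : IsSimilarityMatrix A Q) {σ : ℝ}
    (hσ : 0 ≤ σ) (hB : supMu A Q ≤ dilationFactor A ^ (2 - σ)) :
    ∃ C : ℝ, ∀ ξ, phiHat A Q ξ ≤ C * (1 + ‖ξ‖) ^ (-σ) := by
  have hφ := phiHat_nonneg (det_ne_zero_of_one_lt_absDet hA) hQ.isSymm
  have hρ := one_lt_dilationFactor hA
  have : 0 < dilationFactor A := one_pos.trans hρ
  obtain ⟨K, hK, hnorm⟩ := exists_energyNorm_le_mul 1 hQ.isUnit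
  obtain ⟨L, hL, hlower⟩ := exists_energyNorm_sq_le_G Q hQ.isSymm hQ.isUnit
  obtain ⟨M, hM⟩ := exists_G_le hQ.isSymm
  obtain ⟨P, hP⟩ := (isCompact_closedBall (0 : Fin d → ℝ) Real.pi).exists_bound_of_continuousOn
    (continuous_phiHat hA hQ).continuousOn
  -- Rescaled so that the annulus `1 ≤ N ≤ ρ` lies in the cube where `G` vanishes only at `0`.
  set r : ℝ := Real.pi / (K * dilationFactor A)
  have hr : 0 < r := by positivity
  set N : (Fin d → ℝ) → ℝ := fun ξ => energyNorm Q ξ / r with hN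
  have hsup (ξ : Fin d → ℝ) : ‖ξ‖ ≤ K * r * N ξ := by
    rw [mul_assoc, mul_div_cancel₀ _ hr.ne']
    exact (norm_le_energyNorm_one ξ).trans (hnorm ξ)
  have hball (ξ : Fin d → ℝ) (hξ : N ξ ≤ dilationFactor A) : ‖ξ‖ ≤ Real.pi := by
    refine (hsup ξ).trans ?_
    calc K * r * N ξ ≤ K * r * dilationFactor A := by gcongr
      _ = Real.pi := by simp only [r]; field_simp
  obtain ⟨C, hC⟩ := exists_le_mul_one_add_rpow_neg (N := N) (g := G Q) (δ := r ^ 2 / L) hρ hσ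
    (by positivity) (fun ξ => div_nonneg (energyNorm_nonneg Q ξ) hr.le)
    (fun ξ => by simp only [hN, hQ.energyNorm_invTranspose_mulVec, mul_div_assoc])
    (mask_nonneg (det_ne_zero_of_one_lt_absDet hA) hQ.isSymm) hφ
    (phiHat_eq_mask_mul_phiHat hA hQ) (mask_mul_G_le_rpow_mul hA hQ hB) hM
    (fun ξ h1 hξ => by
      rw [div_le_iff₀' hL]
      refine le_trans ?_ (hlower ξ (hball ξ hξ))
      have := (one_le_div hr).1 h1
      gcongr)
    (fun ξ hξ => (le_abs_self _).trans (hP ξ (by simpa using hball ξ hξ)))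
  refine ⟨C * (1 + K * r) ^ σ, fun ξ => (hC ξ).trans ?_⟩
  have hNξ : 0 ≤ N ξ := div_nonneg (energyNorm_nonneg Q ξ) hr.le
  have hC0 : 0 ≤ C := nonneg_of_mul_nonneg_left ((hφ ξ).trans (hC ξ)) (by positivity)
  rw [mul_assoc]
  gcongr
  refine rpow_neg_le_mul_rpow_neg (by positivity) (by positivity) hσ ?_
  nlinarith [hsup ξ, mul_pos hK hr]

lemma exists_lt_and_le_rpow_sub {ρ x s t : ℝ} (hρ : 0 < ρ) (h : x < ρ ^ (s - t)) :
    ∃ σ, t < σ ∧ x ≤ ρ ^ (s - σ) := by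
  have hcont : ContinuousAt (fun σ => ρ ^ (s - σ)) t :=
    ContinuousAt.rpow (by fun_prop) (by fun_prop) (Or.inl hρ.ne')
  obtain ⟨σ, hx, hσ⟩ := ((hcont.eventually (lt_mem_nhds h)).filter_mono nhdsWithin_le_nhds
    |>.and self_mem_nhdsWithin : ∀ᶠ σ in nhdsWithin t (Set.Ioi t), _).exists
  exact ⟨σ, hσ, hx.le⟩

lemma exists_phiHat_pow_sq_le (hA : 1 < absDet A) (hQ : IsSimilarityMatrix A Q) {m : ℕ}
    (hm : 1 ≤ m) (hB : supMu A Q < absDet A ^ (2 / (d : ℝ) - 1 / (2 * (m : ℝ)))) :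
    ∃ C τ : ℝ, d < τ ∧ ∀ ξ, (phiHat A Q ξ ^ m) ^ 2 ≤ C * (1 + ‖ξ‖) ^ (-τ) := by
  have hd : (0 : ℝ) < d := Nat.cast_pos.2 (dim_pos_of_one_lt_absDet hA)
  have hm0 : (0 : ℝ) < m := Nat.cast_pos.2 hm
  have hexp : 2 / (d : ℝ) - 1 / (2 * (m : ℝ)) = (2 - d / (2 * m)) / d := by field_simp
  rw [hexp, ← dilationFactor_rpow] at hB
  obtain ⟨σ, hσ, hBσ⟩ :=
    exists_lt_and_le_rpow_sub (one_pos.trans (one_lt_dilationFactor hA)) hB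
  obtain ⟨C, hC⟩ := exists_phiHat_le_mul_rpow_neg hA hQ (hσ.le.trans' (by positivity)) hBσ
  refine ⟨C ^ (m * 2), σ * (m * 2 : ℕ), ?_, fun ξ => ?_⟩
  · rw [div_lt_iff₀ (by positivity)] at hσ
    push_cast
    linarith
  · have hφ := phiHat_nonneg (det_ne_zero_of_one_lt_absDet hA) hQ.isSymm ξ
    calc (phiHat A Q ξ ^ m) ^ 2 = phiHat A Q ξ ^ (m * 2) := (pow_mul _ _ _).symm
      _ ≤ (C * (1 + ‖ξ‖) ^ (-σ)) ^ (m * 2) := by gcongr; exact hC ξ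
      _ = C ^ (m * 2) * (1 + ‖ξ‖) ^ (-(σ * (m * 2 : ℕ))) := by
        rw [mul_pow, ← neg_mul, Real.rpow_mul_natCast (by positivity)]

end PhiHat

/-! ### Lattice sums -/

section LatticeSums

variable {ι : Type*} [Fintype ι]

lemma summable_norm_intVec_rpow {τ : ℝ} (hτ : Fintype.card ι < τ) :
    Summable fun k : ι → ℤ => ‖intVec k‖ ^ (-τ) := by
  classical
  let L : Submodule ℤ (ι → ℝ) := Submodule.span ℤ (Set.range (Pi.basisFun ℝ ι))
  have hrank : Module.finrank ℤ L = Fintype.card ι := by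
    rw [ZLattice.rank ℝ, Module.finrank_fintype_fun_eq_card]
  have hmem (k : ι → ℤ) : intVec k ∈ L :=
    ((Pi.basisFun ℝ ι).mem_span_iff_repr_mem ℤ _).2 fun i => ⟨k i, by simp⟩
  have hsum : Summable fun z : L => ‖(z : ι → ℝ)‖ ^ (-τ) :=
    ZLattice.summable_norm_rpow L (-τ) (by rw [hrank]; linarith)
  have hinj : Function.Injective fun k : ι → ℤ => (⟨intVec k, hmem k⟩ : L) := fun k l hkl =>
    funext fun i => Int.cast_injective (congrFun (congrArg Subtype.val hkl) i)
  simpa only [Function.comp_def] using hsum.comp_injective hinj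

lemma summable_one_add_norm_intVec_rpow {τ : ℝ} (hτ : Fintype.card ι < τ) :
    Summable fun k : ι → ℤ => (1 + ‖intVec k‖) ^ (-τ) := by
  refine (summable_norm_intVec_rpow hτ).of_norm_bounded_eventually ?_
  filter_upwards [(Set.finite_singleton (0 : ι → ℤ)).compl_mem_cofinite] with k hk
  have hpos : 0 < ‖intVec k‖ := norm_pos_iff.2 fun h =>
    hk (funext fun i => Int.cast_eq_zero.1 (congrFun h i))
  have : 0 ≤ τ := (Nat.cast_nonneg _).trans hτ.le
  rw [Real.norm_of_nonneg (by positivity)]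
  exact Real.rpow_le_rpow_of_nonpos hpos (by linarith) (by linarith)

lemma one_add_norm_intVec_le (ξ : ι → ℝ) (k : ι → ℤ) :
    1 + ‖intVec k‖ ≤ (1 + ‖ξ‖) * (1 + ‖ξ + latticePoint k‖) := by
  have hnorm : ‖latticePoint k‖ = 2 * Real.pi * ‖intVec k‖ := by
    rw [latticePoint, norm_smul, Real.norm_of_nonneg Real.two_pi_pos.le]
  have htriangle : ‖latticePoint k‖ ≤ ‖ξ + latticePoint k‖ + ‖ξ‖ := by
    simpa using norm_sub_le (ξ + latticePoint k) ξ
  have hk := norm_nonneg (intVec k)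
  have hprod := mul_nonneg (norm_nonneg ξ) (norm_nonneg (ξ + latticePoint k))
  nlinarith [Real.pi_gt_three]

lemma exists_summable_majorant {g : (ι → ℝ) → ℝ} {C τ : ℝ} (hτ : Fintype.card ι < τ)
    (hg : ∀ ξ, g ξ ≤ C * (1 + ‖ξ‖) ^ (-τ)) (R : ℝ) :
    ∃ M : (ι → ℤ) → ℝ, Summable M ∧ ∀ ξ, ‖ξ‖ ≤ R → ∀ k, g (ξ + latticePoint k) ≤ M k := by
  have hτ0 : 0 ≤ τ := (Nat.cast_nonneg _).trans hτ.le
  refine ⟨fun k => |C| * ((1 + R) ^ τ * (1 + ‖intVec k‖) ^ (-τ)),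
    ((summable_one_add_norm_intVec_rpow hτ).mul_left _).mul_left _, fun ξ hξ k => ?_⟩
  have hR : 0 ≤ R := (norm_nonneg ξ).trans hξ
  calc g (ξ + latticePoint k)
      ≤ C * (1 + ‖ξ + latticePoint k‖) ^ (-τ) := hg _
    _ ≤ |C| * (1 + ‖ξ + latticePoint k‖) ^ (-τ) := by gcongr; exact le_abs_self C
    _ ≤ |C| * ((1 + R) ^ τ * (1 + ‖intVec k‖) ^ (-τ)) := by
        gcongr
        refine rpow_neg_le_mul_rpow_neg (by positivity) (by positivity) hτ0 ?_
        exact (one_add_norm_intVec_le ξ k).trans (by gcongr)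

end LatticeSums

/-! ### Periodization -/

section Periodization

variable {ι : Type*}

/-- The half-open unit cube centred at the origin, a fundamental domain for the integer
translations. -/
def unitCube (ι : Type*) : Set (EuclideanSpace ℝ ι) :=
  {ν | ∀ i, ν i ∈ Set.Ioc (-(1 / 2) : ℝ) (-(1 / 2) + 1)}

/-- The class of the vector `ν` modulo integer vectors. -/
def toTorus (ν : EuclideanSpace ℝ ι) : UnitAddTorus ι := fun i => (ν i : UnitAddCircle)

@[fun_prop]
lemma continuous_toTorus : Continuous (toTorus : EuclideanSpace ℝ ι → UnitAddTorus ι) :=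
  continuous_pi fun i => (AddCircle.continuous_mk' 1).comp (PiLp.continuous_apply 2 _ i)

lemma toTorus_add_intVec (ν : EuclideanSpace ℝ ι) (k : ι → ℤ) :
    toTorus (ν + WithLp.toLp 2 (intVec k)) = toTorus ν := by
  ext i
  simp [toTorus]

lemma existsUnique_add_intVec_mem_unitCube (ν : EuclideanSpace ℝ ι) :
    ∃! k : ι → ℤ, ν + WithLp.toLp 2 (intVec k) ∈ unitCube ι := by
  choose k hk huniq using fun i => existsUnique_add_zsmul_mem_Ioc one_pos (ν i) (-(1 / 2) : ℝ)
  simp only [zsmul_one] at hk huniq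
  exact ⟨k, hk, fun l hl => funext fun i => huniq i (l i) (hl i)⟩

lemma measurableSet_unitCube [Countable ι] : MeasurableSet (unitCube ι) := by
  simp only [unitCube, Set.ofPred_forall]
  exact MeasurableSet.iInter fun i => measurableSet_Ioc.preimage (by fun_prop)

lemma isBounded_unitCube [Finite ι] : Bornology.IsBounded (unitCube ι) := by
  have := Fintype.ofFinite ι
  have hbox : Bornology.IsBounded
      (Set.univ.pi fun _ : ι => Set.Ioc (-(1 / 2) : ℝ) (-(1 / 2) + 1)) :=
    Bornology.IsBounded.pi fun _ => Metric.isBounded_Ioc _ _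
  refine ((PiLp.antilipschitzWith_ofLp 2 _).isBounded_preimage hbox).subset ?_
  exact fun ν hν i _ => hν i

variable [Fintype ι]

/-- The `ℤ^ι`-periodization of a nonnegative function. -/
noncomputable def periodization (F : EuclideanSpace ℝ ι → ENNReal) (ν : EuclideanSpace ℝ ι) :
    ENNReal :=
  ∑' k : ι → ℤ, F (ν + WithLp.toLp 2 (intVec k))

lemma lintegral_eq_setLIntegral_periodization {F : EuclideanSpace ℝ ι → ENNReal}
    (hF : Measurable F) : ∫⁻ ν, F ν = ∫⁻ ν in unitCube ι, periodization F ν := by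
  let shift (k : ι → ℤ) (ν : EuclideanSpace ℝ ι) := ν + WithLp.toLp 2 (intVec k)
  have hmeas (k : ι → ℤ) : Measurable (shift k) := measurable_add_const _
  have hcover : ⋃ k, shift k ⁻¹' unitCube ι = Set.univ := Set.eq_univ_of_forall fun ν =>
    Set.mem_iUnion.2 (existsUnique_add_intVec_mem_unitCube ν).exists
  have hdisj : Pairwise (Function.onFun Disjoint fun k => shift k ⁻¹' unitCube ι) :=
    fun k l hkl => Set.disjoint_left.2 fun ν hk hl =>
      hkl ((existsUnique_add_intVec_mem_unitCube ν).unique hk hl)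
  have htranslate (k : ι → ℤ) : ∫⁻ ν in shift k ⁻¹' unitCube ι, F ν =
      ∫⁻ ν in unitCube ι, F (shift (-k) ν) := by
    rw [← (measurePreserving_add_right volume _).setLIntegral_comp_preimage_emb
      (measurableEmbedding_addRight (WithLp.toLp 2 (intVec k))) _ (unitCube ι)]
    refine lintegral_congr fun ν => congrArg F ?_
    ext i
    simp [shift, intVec]
  calc ∫⁻ ν, F ν = ∑' k, ∫⁻ ν in shift k ⁻¹' unitCube ι, F ν := by
        rw [← lintegral_iUnion (fun k => hmeas k measurableSet_unitCube) hdisj, hcover,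
          Measure.restrict_univ]
    _ = ∑' k, ∫⁻ ν in unitCube ι, F (shift (-k) ν) := tsum_congr htranslate
    _ = ∑' k, ∫⁻ ν in unitCube ι, F (shift k ν) :=
        (Equiv.neg (ι → ℤ)).tsum_eq fun k => ∫⁻ ν in unitCube ι, F (shift k ν)
    _ = ∫⁻ ν in unitCube ι, periodization F ν :=
        (lintegral_tsum fun k => (hF.comp (hmeas k)).aemeasurable).symm

/-- The trigonometric polynomial `∑ₖ cₖ e^{-2π i k·ν}`. -/
noncomputable def trigPoly (c : (ι → ℤ) →₀ ℂ) (ν : EuclideanSpace ℝ ι) : ℂ :=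
  ∑ k ∈ c.support, c k * UnitAddTorus.mFourier (-k) (toTorus ν)

@[fun_prop]
lemma continuous_trigPoly (c : (ι → ℤ) →₀ ℂ) : Continuous (trigPoly c) := by
  unfold trigPoly
  fun_prop

lemma trigPoly_add_intVec (c : (ι → ℤ) →₀ ℂ) (ν : EuclideanSpace ℝ ι) (k : ι → ℤ) :
    trigPoly c (ν + WithLp.toLp 2 (intVec k)) = trigPoly c ν := by
  simp only [trigPoly, toTorus_add_intVec]

lemma integral_unitCube_norm_sq_trigPoly (c : (ι → ℤ) →₀ ℂ) :
    ∫ ν in unitCube ι, ‖trigPoly c ν‖ ^ 2 = ∑ k ∈ c.support, ‖c k‖ ^ 2 := by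
  have hortho := (UnitAddTorus.orthonormal_mFourier (d := ι)).comp
    (Neg.neg : (ι → ℤ) → ι → ℤ) neg_injective
  have hinner := hortho.inner_sum c c c.support
  have heval (x : ι → ℝ) :
      (∑ k ∈ c.support, c k • UnitAddTorus.mFourier (-k)) (fun i => (x i : UnitAddCircle)) =
        trigPoly c (WithLp.toLp 2 x) := by
    simp only [trigPoly, ContinuousMap.coe_sum, ContinuousMap.coe_smul, Finset.sum_apply,
      Pi.smul_apply, smul_eq_mul]
    rfl
  simp only [Function.comp_apply, ← map_smul, ← map_sum] at hinner
  rw [ContinuousMap.inner_toLp, UnitAddTorus.integral_preimage _ fun _ => -(1 / 2)] at hinner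
  simp only [heval, Complex.mul_conj', Complex.conj_mul'] at hinner
  rw [← (PiLp.volume_preserving_toLp ι).setIntegral_preimage_emb
    (MeasurableEquiv.toLp 2 (ι → ℝ)).measurableEmbedding]
  apply Complex.ofReal_injective
  rw [← integral_complex_ofReal]
  push_cast
  exact hinner

lemma setLIntegral_unitCube_enorm_sq_trigPoly (c : (ι → ℤ) →₀ ℂ) :
    ∫⁻ ν in unitCube ι, ‖trigPoly c ν‖ₑ ^ 2 = ENNReal.ofReal (∑ k ∈ c.support, ‖c k‖ ^ 2) := by
  rw [← integral_unitCube_norm_sq_trigPoly, ofReal_integral_eq_lintegral_ofReal]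
  · refine lintegral_congr fun ν => ?_
    rw [ENNReal.ofReal_pow (norm_nonneg _), ofReal_norm]
  · have hcont : Continuous fun ν => ‖trigPoly c ν‖ ^ 2 := by fun_prop
    exact (hcont.continuousOn.integrableOn_compact
      isBounded_unitCube.isCompact_closure).mono_set subset_closure
  · exact Filter.Eventually.of_forall fun ν => by positivity

lemma lintegral_enorm_sq_trigPoly_mul {g : EuclideanSpace ℝ ι → ℂ} (hg : Measurable g)
    (c : (ι → ℤ) →₀ ℂ) :
    ∫⁻ ν, ‖trigPoly c ν * g ν‖ₑ ^ 2 =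
      ∫⁻ ν in unitCube ι, ‖trigPoly c ν‖ₑ ^ 2 * periodization (fun ν => ‖g ν‖ₑ ^ 2) ν := by
  rw [lintegral_eq_setLIntegral_periodization (by fun_prop)]
  refine lintegral_congr fun ν => ?_
  simp only [periodization, trigPoly_add_intVec, enorm_mul, mul_pow, ENNReal.tsum_mul_left]

lemma lintegral_enorm_sq_trigPoly_mul_le {g : EuclideanSpace ℝ ι → ℂ} (hg : Measurable g)
    {b : ℝ} (hgb : ∀ ν ∈ unitCube ι, periodization (fun ν => ‖g ν‖ₑ ^ 2) ν ≤ ENNReal.ofReal b)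
    (c : (ι → ℤ) →₀ ℂ) :
    ∫⁻ ν, ‖trigPoly c ν * g ν‖ₑ ^ 2 ≤ ENNReal.ofReal (b * ∑ k ∈ c.support, ‖c k‖ ^ 2) := by
  rw [lintegral_enorm_sq_trigPoly_mul hg,
    ENNReal.ofReal_mul' (Finset.sum_nonneg fun _ _ => sq_nonneg _),
    ← setLIntegral_unitCube_enorm_sq_trigPoly, ← lintegral_const_mul' _ _ ENNReal.ofReal_ne_top]
  refine setLIntegral_mono' measurableSet_unitCube fun ν hν => ?_
  rw [mul_comm]
  gcongr
  exact hgb ν hν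

lemma le_lintegral_enorm_sq_trigPoly_mul {g : EuclideanSpace ℝ ι → ℂ} (hg : Measurable g)
    {a : ℝ} (hag : ∀ ν ∈ unitCube ι, ENNReal.ofReal a ≤ periodization (fun ν => ‖g ν‖ₑ ^ 2) ν)
    (c : (ι → ℤ) →₀ ℂ) :
    ENNReal.ofReal (a * ∑ k ∈ c.support, ‖c k‖ ^ 2) ≤ ∫⁻ ν, ‖trigPoly c ν * g ν‖ₑ ^ 2 := by
  rw [lintegral_enorm_sq_trigPoly_mul hg,
    ENNReal.ofReal_mul' (Finset.sum_nonneg fun _ _ => sq_nonneg _),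
    ← setLIntegral_unitCube_enorm_sq_trigPoly, ← lintegral_const_mul' _ _ ENNReal.ofReal_ne_top]
  refine setLIntegral_mono' measurableSet_unitCube fun ν hν => ?_
  rw [mul_comm]
  gcongr
  exact hag ν hν

lemma memLp_two_of_periodization_le {g : EuclideanSpace ℝ ι → ℂ} (hg : Measurable g) {b : ℝ}
    (hgb : ∀ ν ∈ unitCube ι, periodization (fun ν => ‖g ν‖ₑ ^ 2) ν ≤ ENNReal.ofReal b) :
    MemLp g 2 := by
  have hfin : ∫⁻ ν, ‖g ν‖ₑ ^ 2 < ⊤ := by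
    rw [lintegral_eq_setLIntegral_periodization (by fun_prop)]
    exact setLIntegral_lt_top_of_le_nnreal isBounded_unitCube.measure_lt_top.ne
      ⟨b.toNNReal, hgb⟩
  refine ⟨hg.aestronglyMeasurable, ?_⟩
  rw [eLpNorm_lt_top_iff_lintegral_rpow_enorm_lt_top two_ne_zero ENNReal.ofNat_ne_top]
  simpa using hfin

end Periodization

/-! ### Translations and the Fourier transform on `L²` -/

section Translation

variable {V : Type*} [NormedAddCommGroup V] [InnerProductSpace ℝ V] [FiniteDimensional ℝ V]
  [MeasurableSpace V] [BorelSpace V]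
  {E : Type*} [NormedAddCommGroup E] [InnerProductSpace ℂ E]

lemma fourierInv_compSubConstCLM_neg (f : 𝓢(V, ℂ)) (v ν : V) :
    𝓕⁻ (f.compSubConstCLM ℂ (-v)) ν = Real.fourierChar (-inner ℝ v ν) • 𝓕⁻ f ν := by
  have hcomp : ⇑(f.compSubConstCLM ℂ (-v)) = f ∘ fun x => x + v := by
    ext x
    simp
  rw [SchwartzMap.fourierInv_coe, SchwartzMap.fourierInv_coe, hcomp]
  exact congrFun (VectorFourier.fourierIntegral_comp_add_right Real.fourierChar volume
    (-innerₗ V) f v) ν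

lemma memLp_fourierChar_smul (v : V) {g : V → E} (hg : MemLp g 2) :
    MemLp (fun ν => Real.fourierChar (-inner ℝ v ν) • g ν) 2 := by
  have hcont : Continuous fun ν : V => Real.fourierChar (-inner ℝ v ν) :=
    Real.continuous_fourierChar.comp (by fun_prop)
  exact hg.congr_norm (hcont.aestronglyMeasurable.smul hg.1)
    (Filter.Eventually.of_forall fun ν => (Circle.norm_smul _ _).symm)

variable [CompleteSpace E]

lemma toTemperedDistribution_injective :
    Function.Injective fun φ : Lp E 2 (volume : Measure V) => (φ : 𝓢'(V, E)) :=
  LinearMap.ker_eq_bot.1 (Lp.ker_toTemperedDistributionCLM_eq_bot (F := E) (p := 2)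
    (μ := (volume : Measure V)))

lemma coeFn_fourier_compMeasurePreserving_sub (v : V) (φ : Lp E 2 (volume : Measure V)) :
    (𝓕 (Lp.compMeasurePreserving (fun x => x - v) (measurePreserving_sub_right volume v) φ) :
      Lp E 2 (volume : Measure V)) =ᵐ[volume]
      fun ν => Real.fourierChar (-inner ℝ v ν) • (𝓕 φ : Lp E 2 (volume : Measure V)) ν := by
  have hmem := memLp_fourierChar_smul v (Lp.memLp (𝓕 φ))
  suffices h : 𝓕 (Lp.compMeasurePreserving (fun x => x - v)
      (measurePreserving_sub_right volume v) φ) = hmem.toLp _ from h ▸ hmem.coeFn_toLp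
  apply toTemperedDistribution_injective
  ext f
  -- The adjoint of the translation by `v` on test functions is the translation by `-v`.
  set F := (𝓕 f).compSubConstCLM ℂ (-v) with hF
  have hFinv (ν : V) : 𝓕⁻ F ν = Real.fourierChar (-inner ℝ v ν) • f ν := by
    rw [hF, fourierInv_compSubConstCLM_neg, FourierTransform.fourierInv_fourier_eq]
  simp only [← Lp.fourier_toTemperedDistribution_eq, TemperedDistribution.fourier_apply]
  calc Lp.toTemperedDistribution (Lp.compMeasurePreserving (fun x => x - v)
        (measurePreserving_sub_right volume v) φ) (𝓕 f)
      = ∫ x, 𝓕 f x • φ (x - v) := by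
        rw [Lp.toTemperedDistribution_apply]
        refine integral_congr_ae ?_
        filter_upwards [Lp.coeFn_compMeasurePreserving φ
          (measurePreserving_sub_right (volume : Measure V) v)] with x hx
        rw [hx, Function.comp_apply]
    _ = ∫ x, F x • φ x := by
        rw [← integral_sub_right_eq_self (fun x => F x • φ x) v]
        simp [hF]
    _ = (φ : 𝓢'(V, E)) (𝓕 (𝓕⁻ F)) := by
        rw [FourierTransform.fourier_fourierInv_eq, Lp.toTemperedDistribution_apply]
    _ = ((𝓕 φ : Lp E 2 (volume : Measure V)) : 𝓢'(V, E)) (𝓕⁻ F) := by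
        rw [← Lp.fourier_toTemperedDistribution_eq, TemperedDistribution.fourier_apply]
    _ = (hmem.toLp _ : 𝓢'(V, E)) f := by
        rw [Lp.toTemperedDistribution_apply, Lp.toTemperedDistribution_apply]
        refine integral_congr_ae ?_
        filter_upwards [hmem.coeFn_toLp] with ν hν
        rw [hν, hFinv, smul_assoc, smul_comm]

lemma ofReal_norm_sq_eq_lintegral {α : Type*} [MeasurableSpace α] {μ : Measure α}
    {E : Type*} [NormedAddCommGroup E] (φ : Lp E 2 μ) :
    ENNReal.ofReal (‖φ‖ ^ 2) = ∫⁻ x, ‖φ x‖ₑ ^ 2 ∂μ := by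
  have h := eLpNorm_nnreal_pow_eq_lintegral (f := φ) (μ := μ) (p := 2) two_ne_zero
  rw [ENNReal.ofReal_pow (norm_nonneg _), ofReal_norm, Lp.enorm_def]
  simpa using h

lemma fourier_eq_integral_iff {g : V → ℂ} (hg : MemLp g 2) (T : 𝓢'(V, ℂ)) :
    (∀ f : 𝓢(V, ℂ), Integrable (fun ν => f ν * g ν) ∧ (𝓕 T) f = ∫ ν, f ν * g ν) ↔
      T = ((𝓕⁻ (hg.toLp g) : Lp ℂ 2 (volume : Measure V)) : 𝓢'(V, ℂ)) := by
  have hpair (f : 𝓢(V, ℂ)) :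
      ((hg.toLp g : Lp ℂ 2 (volume : Measure V)) : 𝓢'(V, ℂ)) f = ∫ ν, f ν * g ν := by
    rw [Lp.toTemperedDistribution_apply]
    refine integral_congr_ae ?_
    filter_upwards [hg.coeFn_toLp] with ν hν
    rw [hν, smul_eq_mul]
  rw [← Lp.fourierInv_toTemperedDistribution_eq]
  constructor
  · intro hT
    rw [← FourierTransform.fourierInv_fourier_eq (F := 𝓢'(V, ℂ)) T]
    congr 1
    ext f
    rw [(hT f).2, hpair]
  · rintro rfl f
    exact ⟨(f.memLp 2).integrable_mul hg, by rw [FourierTransform.fourier_fourierInv_eq, hpair]⟩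

end Translation

/-! ### Riesz bounds for integer shifts -/

lemma fourierChar_neg_inner_intVec {ι : Type*} [Fintype ι] (k : ι → ℤ) (ν : EuclideanSpace ℝ ι) :
    (Real.fourierChar (-inner ℝ (WithLp.toLp 2 (intVec k)) ν) : ℂ) =
      UnitAddTorus.mFourier (-k) (toTorus ν) := by
  simp only [Real.fourierChar_apply, UnitAddTorus.mFourier, ContinuousMap.coe_mk, toTorus,
    fourier_coe_apply, ← Complex.exp_sum, PiLp.inner_apply, Pi.neg_apply]
  congr 1
  simp only [RCLike.inner_apply, conj_trivial, intVec]
  push_cast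
  rw [mul_neg, Finset.mul_sum, ← Finset.sum_neg_distrib, Finset.sum_mul]
  refine Finset.sum_congr rfl fun i _ => ?_
  ring

section RieszBounds

variable {d : ℕ} (φ : Lp ℂ 2 (volume : Measure (EuclideanSpace ℝ (Fin d))))

lemma coeFn_fourier_integerShift (k : Fin d → ℤ) :
    (𝓕 (integerShift k φ) : Lp ℂ 2 (volume : Measure (EuclideanSpace ℝ (Fin d)))) =ᵐ[volume]
      fun ν => UnitAddTorus.mFourier (-k) (toTorus ν) *
        (𝓕 φ : Lp ℂ 2 (volume : Measure (EuclideanSpace ℝ (Fin d)))) ν := by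
  filter_upwards [coeFn_fourier_compMeasurePreserving_sub (WithLp.toLp 2 (intVec k)) φ] with ν hν
  rw [integerShift, hν, Circle.smul_def, fourierChar_neg_inner_intVec, smul_eq_mul]

lemma coeFn_fourier_sum_integerShift (c : (Fin d → ℤ) →₀ ℂ) :
    (𝓕 (∑ k ∈ c.support, c k • integerShift k φ) :
      Lp ℂ 2 (volume : Measure (EuclideanSpace ℝ (Fin d)))) =ᵐ[volume]
      fun ν => trigPoly c ν * (𝓕 φ : Lp ℂ 2 (volume : Measure (EuclideanSpace ℝ (Fin d)))) ν := by
  have hlin : 𝓕 (∑ k ∈ c.support, c k • integerShift k φ) =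
      ∑ k ∈ c.support, c k • 𝓕 (integerShift k φ) := by
    exact (map_sum (Lp.fourierTransformₗᵢ (EuclideanSpace ℝ (Fin d)) ℂ) _ _).trans
      (Finset.sum_congr rfl fun k _ => map_smul _ _ _)
  rw [hlin]
  have hterm : ∀ᵐ ν, ∀ k : Fin d → ℤ, (c k • 𝓕 (integerShift k φ) :
      Lp ℂ 2 (volume : Measure (EuclideanSpace ℝ (Fin d)))) ν =
        c k * UnitAddTorus.mFourier (-k) (toTorus ν) *
          (𝓕 φ : Lp ℂ 2 (volume : Measure (EuclideanSpace ℝ (Fin d)))) ν := by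
    refine ae_all_iff.2 fun k => ?_
    filter_upwards [Lp.coeFn_smul (c k) (𝓕 (integerShift k φ)), coeFn_fourier_integerShift φ k]
      with ν hsmul hshift
    rw [hsmul, Pi.smul_apply, hshift, smul_eq_mul, mul_assoc]
  filter_upwards [Lp.coeFn_fun_finsetSum c.support fun k => c k • 𝓕 (integerShift k φ), hterm]
    with ν hsum hν
  rw [hsum, trigPoly, Finset.sum_mul]
  exact Finset.sum_congr rfl fun k _ => hν k

lemma ofReal_norm_sq_sum_integerShift {g : EuclideanSpace ℝ (Fin d) → ℂ}
    (hφ : (𝓕 φ : Lp ℂ 2 (volume : Measure (EuclideanSpace ℝ (Fin d)))) =ᵐ[volume] g)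
    (c : (Fin d → ℤ) →₀ ℂ) :
    ENNReal.ofReal (‖∑ k ∈ c.support, c k • integerShift k φ‖ ^ 2) =
      ∫⁻ ν, ‖trigPoly c ν * g ν‖ₑ ^ 2 := by
  rw [← Lp.norm_fourier_eq, ofReal_norm_sq_eq_lintegral]
  refine lintegral_congr_ae ?_
  filter_upwards [coeFn_fourier_sum_integerShift φ c, hφ] with ν hsum hν
  rw [hsum, hν]

variable {φ}

lemma formsRieszBasis_integerShift {g : EuclideanSpace ℝ (Fin d) → ℂ} (hg : Measurable g)
    (hφ : (𝓕 φ : Lp ℂ 2 (volume : Measure (EuclideanSpace ℝ (Fin d)))) =ᵐ[volume] g)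
    {a b : ℝ} (ha : 0 < a) (hab : a ≤ b)
    (hag : ∀ ν ∈ unitCube (Fin d),
      ENNReal.ofReal a ≤ periodization (fun ν => ‖g ν‖ₑ ^ 2) ν)
    (hgb : ∀ ν ∈ unitCube (Fin d),
      periodization (fun ν => ‖g ν‖ₑ ^ 2) ν ≤ ENNReal.ofReal b) :
    FormsRieszBasis fun k : Fin d → ℤ => integerShift k φ := by
  have hb : 0 ≤ b := ha.le.trans hab
  refine ⟨a, b, ha, hab, fun c => ⟨?_, ?_⟩⟩
  · rw [← ENNReal.ofReal_le_ofReal_iff (by positivity), ofReal_norm_sq_sum_integerShift φ hφ]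
    exact le_lintegral_enorm_sq_trigPoly_mul hg hag c
  · rw [← ENNReal.ofReal_le_ofReal_iff (by positivity), ofReal_norm_sq_sum_integerShift φ hφ]
    exact lintegral_enorm_sq_trigPoly_mul_le hg hgb c

end RieszBounds

/-! ### The elliptic scaling function -/

section ScalingSymbol

variable {d : ℕ} {A : Matrix (Fin d) (Fin d) ℤ} {Q : Matrix (Fin d) (Fin d) ℝ}

/-- The Fourier transform of the elliptic scaling function of order `m`, in the variable `ν`
with `ξ = 2πν` that matches Mathlib's normalization of `𝓕`. -/
noncomputable def scalingSymbol (A : Matrix (Fin d) (Fin d) ℤ) (Q : Matrix (Fin d) (Fin d) ℝ)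
    (m : ℕ) (ν : EuclideanSpace ℝ (Fin d)) : ℂ :=
  ((phiHat A Q ((2 * Real.pi) • ν.ofLp) ^ m : ℝ) : ℂ)

lemma continuous_scalingSymbol (hA : 1 < absDet A) (hQ : IsSimilarityMatrix A Q) (m : ℕ) :
    Continuous (scalingSymbol A Q m) := by
  have hphi := continuous_phiHat hA hQ
  unfold scalingSymbol
  fun_prop

lemma enorm_sq_scalingSymbol (A : Matrix (Fin d) (Fin d) ℤ) (Q : Matrix (Fin d) (Fin d) ℝ)
    (m : ℕ) (ν : EuclideanSpace ℝ (Fin d)) :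
    ‖scalingSymbol A Q m ν‖ₑ ^ 2 =
      ENNReal.ofReal ((phiHat A Q ((2 * Real.pi) • ν.ofLp) ^ m) ^ 2) := by
  rw [scalingSymbol, ← ofReal_norm, ← ENNReal.ofReal_pow (norm_nonneg _), Complex.norm_real,
    Real.norm_eq_abs, sq_abs]

lemma norm_two_pi_smul_le_pi {ν : EuclideanSpace ℝ (Fin d)} (hν : ν ∈ unitCube (Fin d)) :
    ‖(2 * Real.pi) • ν.ofLp‖ ≤ Real.pi := by
  refine (pi_norm_le_iff_of_nonneg Real.pi_pos.le).2 fun i => ?_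
  obtain ⟨hlo, hhi⟩ := hν i
  rw [Pi.smul_apply, smul_eq_mul, Real.norm_eq_abs, abs_le]
  constructor <;> nlinarith [Real.pi_pos]

lemma exists_pos_le_periodization_scalingSymbol (hA : 1 < absDet A)
    (hQ : IsSimilarityMatrix A Q) (m : ℕ) :
    ∃ a : ℝ, 0 < a ∧ ∀ ν ∈ unitCube (Fin d),
      ENNReal.ofReal a ≤ periodization (fun ν => ‖scalingSymbol A Q m ν‖ₑ ^ 2) ν := by
  obtain ⟨a, ha, hphi⟩ := exists_pos_le_phiHat hA hQ
  refine ⟨(a ^ m) ^ 2, by positivity, fun ν hν => ?_⟩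
  calc ENNReal.ofReal ((a ^ m) ^ 2)
      ≤ ‖scalingSymbol A Q m ν‖ₑ ^ 2 := by
        rw [enorm_sq_scalingSymbol]
        gcongr
        exact hphi _ (norm_two_pi_smul_le_pi hν)
    _ = ‖scalingSymbol A Q m (ν + WithLp.toLp 2 (intVec 0))‖ₑ ^ 2 := by
        congr 3
        ext i
        simp
    _ ≤ periodization (fun ν => ‖scalingSymbol A Q m ν‖ₑ ^ 2) ν :=
        ENNReal.le_tsum (f := fun k : Fin d → ℤ =>
          ‖scalingSymbol A Q m (ν + WithLp.toLp 2 (intVec k))‖ₑ ^ 2) 0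

variable {m : ℕ}

lemma exists_summable_majorant_phiHat (hA : 1 < absDet A) (hQ : IsSimilarityMatrix A Q)
    (hm : 1 ≤ m) (hB : supMu A Q < absDet A ^ (2 / (d : ℝ) - 1 / (2 * (m : ℝ)))) (R : ℝ) :
    ∃ M : (Fin d → ℤ) → ℝ, Summable M ∧
      ∀ ξ, ‖ξ‖ ≤ R → ∀ k, (phiHat A Q (ξ + latticePoint k) ^ m) ^ 2 ≤ M k := by
  obtain ⟨C, τ, hτ, hdecay⟩ := exists_phiHat_pow_sq_le hA hQ hm hB
  exact exists_summable_majorant (by simpa using hτ) hdecay R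

lemma exists_periodization_scalingSymbol_le (hA : 1 < absDet A) (hQ : IsSimilarityMatrix A Q)
    (hm : 1 ≤ m) (hB : supMu A Q < absDet A ^ (2 / (d : ℝ) - 1 / (2 * (m : ℝ)))) :
    ∃ b : ℝ, ∀ ν ∈ unitCube (Fin d),
      periodization (fun ν => ‖scalingSymbol A Q m ν‖ₑ ^ 2) ν ≤ ENNReal.ofReal b := by
  obtain ⟨M, hM, hphi⟩ := exists_summable_majorant_phiHat hA hQ hm hB Real.pi
  have hM0 (k : Fin d → ℤ) : 0 ≤ M k :=
    (sq_nonneg _).trans (hphi 0 (by simpa using Real.pi_pos.le) k)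
  refine ⟨∑' k, M k, fun ν hν => ?_⟩
  rw [ENNReal.ofReal_tsum_of_nonneg hM0 hM]
  refine ENNReal.tsum_le_tsum fun k => ?_
  simp only [enorm_sq_scalingSymbol, WithLp.ofLp_add, smul_add]
  exact ENNReal.ofReal_le_ofReal (hphi _ (norm_two_pi_smul_le_pi hν) k)

lemma isEllipticScalingFunction_iff (hmem : MemLp (scalingSymbol A Q m) 2)
    (T : 𝓢'(EuclideanSpace ℝ (Fin d), ℂ)) :
    IsEllipticScalingFunction A Q m T ↔
      T = ((𝓕⁻ (hmem.toLp _) : Lp ℂ 2 (volume : Measure (EuclideanSpace ℝ (Fin d)))) :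
        𝓢'(EuclideanSpace ℝ (Fin d), ℂ)) :=
  fourier_eq_integral_iff hmem T

end ScalingSymbol

end EllipticScaling

theorem mainTheorem10 (d : ℕ) (hd : 1 ≤ d) (A : Matrix (Fin d) (Fin d) ℤ)
    (hA : EllipticScaling.IsDilation A) (hiso : EllipticScaling.IsIsotropic A)
    (Q : Matrix (Fin d) (Fin d) ℝ) (hQ : EllipticScaling.IsSimilarityMatrix A Q)
    (m : ℕ) (hm : 1 ≤ m)
    (hB : EllipticScaling.supMu A Q <
      EllipticScaling.absDet A ^ (2 / (d : ℝ) - 1 / (2 * (m : ℝ)))) :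
    (∃! T : 𝓢'(EuclideanSpace ℝ (Fin d), ℂ), EllipticScaling.IsEllipticScalingFunction A Q m T) ∧
    (∀ T : 𝓢'(EuclideanSpace ℝ (Fin d), ℂ), EllipticScaling.IsEllipticScalingFunction A Q m T →
      ∃ φ : Lp ℂ 2 (volume : Measure (EuclideanSpace ℝ (Fin d))),
        (φ : 𝓢'(EuclideanSpace ℝ (Fin d), ℂ)) = T ∧
        EllipticScaling.FormsRieszBasis
          (fun k : Fin d → ℤ => EllipticScaling.integerShift k φ)) ∧
    (∀ ξ : Fin d → ℝ, Summable (fun k : Fin d → ℤ =>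
      |EllipticScaling.phiHat A Q (ξ + (2 * Real.pi) • (fun i => (k i : ℝ))) ^ m| ^ 2)) := by
  open EllipticScaling in
  have hdet := hA.one_lt_absDet hd
  have hmeas := (continuous_scalingSymbol hdet hQ m).measurable
  obtain ⟨a, ha, hlower⟩ := exists_pos_le_periodization_scalingSymbol hdet hQ m
  obtain ⟨b, hupper⟩ := exists_periodization_scalingSymbol_le hdet hQ hm hB
  have hmem : MemLp (scalingSymbol A Q m) 2 := memLp_two_of_periodization_le hmeas hupper
  have hT (T) := isEllipticScalingFunction_iff hmem T
  set φ := (𝓕⁻ (hmem.toLp _) : Lp ℂ 2 (volume : Measure (EuclideanSpace ℝ (Fin d))))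
  have hφ : 𝓕 φ = hmem.toLp _ := FourierTransform.fourier_fourierInv_eq _
  have hriesz : FormsRieszBasis fun k : Fin d → ℤ => integerShift k φ :=
    formsRieszBasis_integerShift hmeas (hφ ▸ hmem.coeFn_toLp) ha (le_max_left a b) hlower fun ν hν =>
      (hupper ν hν).trans (ENNReal.ofReal_le_ofReal (le_max_right a b))
  refine ⟨⟨φ, (hT _).2 rfl, fun T => (hT T).1⟩, fun T h => ⟨φ, ((hT T).1 h).symm, hriesz⟩,
    fun ξ => ?_⟩
  obtain ⟨M, hM, hle⟩ := exists_summable_majorant_phiHat hdet hQ hm hB ‖ξ‖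
  simp only [sq_abs]
  exact hM.of_nonneg_of_le (fun k => sq_nonneg _) (hle ξ le_rfl)
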